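/- Let $\mathbb K\in\{\mathbb R,\mathbb C\}$, and let $\mathbb N^{<\mathbb N}$ be the set of all finite sequences of natural numbers, including the empty one. Write $\eta\subset\nu$ if $\eta$ is an initial segment of $\nu$, and call $T\subset\mathbb N^{<\mathbb N}$ a tree if $\eta\subset\nu\in T$ implies $\eta\in T$. For vectors $x_\eta$ of a Banach space, $\sum_{\eta}x_\eta$ denotes the limit of $\sum_{\eta\in T}x_\eta$ over the finite trees $T$ directed by inclusion; a basis $\{e_\eta:\eta\in\mathbb N^{<\mathbb N}\}$ and its expansions are understood with respect to this summation. A sum $\sum_{\eta\in S} x_\eta$ over a subset $S$ is obtained by putting $x_\eta=0$ for $\eta\notin S$. *Generalized $\ell^2$-sum.* Let $X$ and $Y_k$ $(k\in\mathbb N)$ be Banach spaces, and for every $k$ let $\|\cdot\|_{X\oplus Y_k}$ be a norm on $X\oplus Y_k$ which extends the norms of $X$ and of $Y_k$ and satisfies $\|x+y\|_{X\oplus Y_k}\ge\|x\|_X$ for $x\in X$, $y\in Y_k$. Let $\Lambda$ be the set of all functionals $x^*+\sum_k\alpha_k y_k^*$ with $x^*\in X^*$, $y_k^*\in Y_k^*$,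 $\|x^*+y_k^*\|_{(X\oplus Y_k)^*}\le 1$ for every $k$, $0\le\alpha_k\le 1$ and $\sum_k\alpha_k^2\le 1$. Then $\Sigma(X\oplus Y_k)$ is the space of all formal sums $z=x+y_1+y_2+\cdots$ with $x\in X$, $y_k\in Y_k$, $\sum_k\|y_k\|_{Y_k}^2<\infty$, with the norm $\|z\|_\Sigma=\sup\{|z^*(z)|:z^*\in\Lambda\}$. **Proposition.** Let $(F,\|\cdot\|_F)$ be a Banach space over $\mathbb K$ with a monotone basis $\{f_1,f_2,\dots\}$ and let $P_n$ be the associated partial sum operators (so $\|P_n\|\le1$ for all $n$). Then there is a Banach space $(E,\|\cdot\|)$ over $\mathbb K$ with a basis $\{e_\eta:\eta\in\mathbb N^{<\mathbb N}\}$ such that the following hold. (a) For all $(n_1,\dots,n_l)\in\mathbb N^{<\mathbb N}$ and all scalars $r_0,\dots,r_l$, $$\Big\|\sum_{i=0}^l r_i e_{(n_1,\dots,n_i)}\Big\|=\Big\|\sum_{i=0}^l r_i f_{i+1}\Big\|_F .$$ (b) For every $\nu=(n_1,\dots,n_l)\in\mathbb N^{<\mathbb N}$ we have $E_\nu=\Sigma(E_{\nu,k})$,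 where $E_\nu=\overline{\mathrm{span}}\{e_\eta:\eta\subset\nu\text{ or }\nu\subset\eta\}$ and $E_{\nu,k}=E_{(n_1,\dots,n_l,k)}$. That is, put $X=\mathrm{span}\{e_\eta:\eta\subset\nu\}$ and $Y_k=\overline{\mathrm{span}}\{e_\eta:(n_1,\dots,n_l,k)\subset\eta\}$. Then $E_{\nu,k}=X\oplus Y_k$, the norm of $E$ on these spaces satisfies the requirements in the definition of the generalized $\ell^2$-sum, and the map sending the formal sum $x+y_1+y_2+\cdots$ to its sum in $E$ is a linear isometry of $\Sigma(X\oplus Y_k)$ onto $E_\nu$. (c) For every tree $T$, the projection $P_T:\sum_{\eta}r_\eta e_\eta\mapsto\sum_{\eta\in T}r_\eta e_\eta$ is well defined on $E$ and satisfies $\|P_T\|\le1$. (d) Let $l\in\mathbb N\cup\{0\}$ and let $c_l>0$ be a constant such that $$\|f\|_F\ge\|P_{l+1}f\|_F+c_l\,\|f-P_{l+1}f\|_F\qquad(f\in F).$$ Then for every $\nu\in\mathbb N^l$ and every $\sum_{\eta}r_\eta e_\eta\in E_\nu$, $$\Big\|\sum_{\eta}r_\eta e_\eta\Big\|\ge\Big\|\sum_{\eta\subset\nu}r_\eta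 e_\eta\Big\|+c_l\Big\|\sum_{\eta\supsetneq\nu}r_\eta e_\eta\Big\| .$$ -/

import Mathlib

open Filter Topology

universe u v

/-! ### Trees of finite sequences -/

/-- A set of finite sequences is a tree if it is closed under initial segments
(`η <+: ν` means that `η` is an initial segment of `ν`). -/
def IsSeqTree (T : Set (List ℕ)) : Prop :=
  ∀ ⦃η ν : List ℕ⦄, η <+: ν → ν ∈ T → η ∈ T

/-- Summation over `List ℕ` along the finite trees directed by inclusion. -/
def finiteTrees : SummationFilter (List ℕ) where
  filter := (atTop : Filter {T : Finset (List ℕ) // IsSeqTree (T : Set (List ℕ))}).map Subtype.val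

/-- The finite trees form a non-empty directed set, so limits along them are unique. -/
instance finiteTrees_neBot : finiteTrees.NeBot := by
  classical
  have : Nonempty {T : Finset (List ℕ) // IsSeqTree (T : Set (List ℕ))} :=
    ⟨⟨∅, fun _ _ _ h => by simp at h⟩⟩
  have : IsDirectedOrder {T : Finset (List ℕ) // IsSeqTree (T : Set (List ℕ))} := by
    refine ⟨fun S T => ⟨⟨S.1 ∪ T.1, ?_⟩, ?_, ?_⟩⟩
    · intro η ν h hν
      rw [Finset.mem_coe, Finset.mem_union] at hν ⊢
      exact hν.imp (fun h' => S.2 h h') (fun h' => T.2 h h')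
    · exact Subtype.coe_le_coe.mp Finset.subset_union_left
    · exact Subtype.coe_le_coe.mp Finset.subset_union_right
  exact ⟨(atTop_neBot).map _⟩

/-! ### The generalized `ℓ²`-sum -/

section GenSum

variable {𝕜 : Type*} [RCLike 𝕜]
  {X : Type*} [NormedAddCommGroup X] [NormedSpace 𝕜 X]
  {Y : ℕ → Type*} [∀ k, NormedAddCommGroup (Y k)] [∀ k, NormedSpace 𝕜 (Y k)]

/-- The standing requirements on the norms of the spaces `X ⊕ Y k`: the norm of `X ⊕ Y k` extends
those of `X` and of `Y k`, and it is monotone. (Such a seminorm is automatically a norm.) -/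
structure IsMonotoneSumNorm (N : ∀ k, Seminorm 𝕜 (X × Y k)) : Prop where
  left : ∀ k (x : X), N k (x, 0) = ‖x‖
  right : ∀ k (y : Y k), N k (0, y) = ‖y‖
  mono : ∀ k (x : X) (y : Y k), ‖x‖ ≤ N k (x, y)

variable (X Y) in
/-- The underlying vector space of `Σ(X ⊕ Y k)`: all formal sums `x + y 0 + y 1 + ⋯`
with `∑ ‖y k‖ ^ 2 < ∞`. -/
abbrev GenSum : Type _ := X × lp Y 2

/-- The set `Λ(X ⊕ Y k)` of functionals `x' + ∑ α k • y' k` on `Σ(X ⊕ Y k)`, where the dual norm of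
`x' + y' k` with respect to `X ⊕ Y k` is at most `1`, `0 ≤ α k ≤ 1` and `∑ α k ^ 2 ≤ 1`. The series
below converges absolutely, since `|y' k y| ≤ ‖y‖` when `N` is as in `IsMonotoneSumNorm`. -/
def genLambda (N : ∀ k, Seminorm 𝕜 (X × Y k)) : Set (GenSum X Y → 𝕜) :=
  {φ | ∃ (x' : StrongDual 𝕜 X) (y' : ∀ k, StrongDual 𝕜 (Y k)) (α : ℕ → ℝ),
    (∀ k (x : X) (y : Y k), ‖x' x + y' k y‖ ≤ N k (x, y)) ∧
    (∀ k, 0 ≤ α k ∧ α k ≤ 1) ∧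
    (Summable fun k => α k ^ 2) ∧ ∑' k, α k ^ 2 ≤ 1 ∧
    ∀ z : GenSum X Y, φ z = x' z.1 + ∑' k, (α k : 𝕜) * y' k (z.2 k)}

/-- The norm of `Σ(X ⊕ Y k)`: the supremum of `|φ z|` over `φ ∈ Λ(X ⊕ Y k)`. -/
noncomputable def genNorm (N : ∀ k, Seminorm 𝕜 (X × Y k)) (z : GenSum X Y) : ℝ :=
  sSup ((fun φ : GenSum X Y → 𝕜 => ‖φ z‖) '' genLambda N)

end GenSum

section Subspaces

variable {𝕜 : Type*} [RCLike 𝕜] {E : Type*} [NormedAddCommGroup E] [NormedSpace 𝕜 E]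

/-- For subspaces `X`, `Y` of `E`, the seminorm `(x, y) ↦ ‖x + y‖` on `X × Y`. -/
noncomputable def ambientNorm (X Y : Submodule 𝕜 E) : Seminorm 𝕜 (X × Y) :=
  (normSeminorm 𝕜 E).comp (X.subtype.coprod Y.subtype)

/-- `Z = Σ(W k)` inside `E`, where `W k = X ⊕ Y k` carries the norm of `E`: these norms are as
required in the definition of the generalized `ℓ²`-sum, and assigning to `(x, (y k))` the sum
`x + ∑ y k` in `E` is a linear isometry of `Σ(X ⊕ Y k)` onto `Z`. -/
def IsGenSum (Z : Submodule 𝕜 E) (W : ℕ → Submodule 𝕜 E) (X : Submodule 𝕜 E)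
    (Y : ℕ → Submodule 𝕜 E) : Prop :=
  (∀ k, Disjoint X (Y k) ∧ X ⊔ Y k = W k) ∧
  IsMonotoneSumNorm (fun k => ambientNorm X (Y k)) ∧
  ∃ Φ : GenSum X (fun k => Y k) ≃ₗ[𝕜] Z, ∀ z : GenSum X (fun k => Y k),
    HasSum (fun k => (z.2 k : E)) ((Φ z : E) - (z.1 : E)) ∧
    ‖Φ z‖ = genNorm (fun k => ambientNorm X (Y k)) z

/-- The closed linear span of the vectors `e η` with `η ∈ S`. -/
def closedSpan (e : List ℕ → E) (S : Set (List ℕ)) : Submodule 𝕜 E :=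
  (Submodule.span 𝕜 (e '' S)).topologicalClosure

end Subspaces

/-! ### Finitely supported vectors indexed by finite sequences -/

/-! Let `N ν` be the prospective norm of `E_ν`, regarded as a seminorm on all finitely supported
vectors. Condition (b) says that `N ν` is the generalized `ℓ²`-sum of the seminorms `N (ν ++ [k])`,
that is, `treeSum N = N`. The tree has no leaves from which to start a recursion, so the equation is
solved as a fixed point problem. The operator `treeSum` is monotone on families with a common bound
at unit vectors. By Hahn–Banach the norms of `F` read along branches form a subsolution, and the
supremum of all subsolutions in a suitable class is a solution (`exists_isBranchFamily_treeSum_eq`).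

The class `IsBranchFamily` records what (a), (c) and (d) need: the value on a branch is prescribed,
tree restrictions are contractive, and the splitting inequality holds. These properties pass through
`treeSum` and through the supremum.

At a fixed point the seminorms are compatible: `N []` agrees with `N ν` on vectors supported on
`comparable ν` (`nil_apply_restr_comparable`). Hence one space, the completion for `N []`, contains
all the `E_ν`. Contractive tree projections yield the basis and (c); (a) and (d) pass to the
completion by density. For (b), tree functionals and functionals in `genLambda` are translated into
each other (`norm_functional_le`, `genNorm_decomp`). An upper and a lower `ℓ²`-estimate show that
the formal sums are exactly the elements of `E_ν`. -/

theorem List.prefix_or_concat_prefix_or_incomparable (ν η : List ℕ) :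
    η <+: ν ∨ (∃ k, ν ++ [k] <+: η) ∨ ¬ (η <+: ν ∨ ν <+: η) := by
  by_cases h : ν <+: η
  · obtain ⟨t, rfl⟩ := h
    cases t with
    | nil => exact Or.inl (by simp)
    | cons k t => exact Or.inr (Or.inl ⟨k, t, by simp⟩)
  · by_cases h' : η <+: ν
    · exact Or.inl h'
    · exact Or.inr (Or.inr (by tauto))

theorem List.not_concat_prefix_of_prefix {ν η : List ℕ} {k : ℕ} (h : η <+: ν) :
    ¬ ν ++ [k] <+: η := fun h' => by
  have h1 := h.length_le
  have h2 := h'.length_le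
  simp at h2
  omega

theorem List.eq_of_concat_prefix {ν η : List ℕ} {j k : ℕ} (h : ν ++ [j] <+: η)
    (h' : ν ++ [k] <+: η) : j = k := by
  have := List.prefix_of_prefix_length_le h h' (by simp)
  simpa using this

/-- The finitely supported scalar families indexed by finite sequences. -/
abbrev TreeVec (𝕜 : Type*) [RCLike 𝕜] := List ℕ →₀ 𝕜

/-- The sequences comparable with `ν`. -/
def comparable (ν : List ℕ) : Set (List ℕ) := {η | η <+: ν ∨ ν <+: η}

/-- The initial segments of `ν`. -/
def prefixes (ν : List ℕ) : Set (List ℕ) := {η | η <+: ν}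

theorem mem_comparable {ν η : List ℕ} : η ∈ comparable ν ↔ η <+: ν ∨ ν <+: η := Iff.rfl

theorem mem_prefixes {ν η : List ℕ} : η ∈ prefixes ν ↔ η <+: ν := Iff.rfl

theorem isSeqTree_prefixes (ν : List ℕ) : IsSeqTree (prefixes ν) :=
  fun _ _ h h' => h.trans h'

theorem isSeqTree_comparable (ν : List ℕ) : IsSeqTree (comparable ν) := by
  rintro η μ h (h' | h')
  · exact Or.inl (h.trans h')
  · exact List.prefix_or_prefix_of_prefix h h'

theorem comparable_concat (ν : List ℕ) (k : ℕ) :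
    comparable (ν ++ [k]) = prefixes ν ∪ {η | ν ++ [k] <+: η} := by
  ext η
  simp only [mem_comparable, Set.mem_union, mem_prefixes, Set.mem_ofPred_eq]
  constructor
  · rintro (h | h)
    · rcases List.prefix_concat_iff.1 h with h | h
      · exact Or.inr (by rw [h])
      · exact Or.inl h
    · exact Or.inr h
  · rintro (h | h)
    · exact Or.inl (h.trans (List.prefix_append _ _))
    · exact Or.inr h

theorem comparable_concat_subset (ν : List ℕ) (k : ℕ) :
    comparable (ν ++ [k]) ⊆ comparable ν := by
  rw [comparable_concat]
  rintro η (h | h)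
  · exact Or.inl h
  · exact Or.inr ((List.prefix_append _ _).trans h)

theorem comparable_nil : comparable [] = Set.univ := by
  ext η; simp [mem_comparable]

/-- The intersection of a tree with a branch consists of the segments below some length. -/
theorem IsSeqTree.exists_length {T : Set (List ℕ)} (hT : IsSeqTree T) (ν : List ℕ) :
    ∃ n, ∀ η, η <+: ν → (η ∈ T ↔ η.length < n) := by
  induction ν using List.reverseRecOn with
  | nil =>
    by_cases h : [] ∈ T
    · exact ⟨1, fun η hη => by simp [List.prefix_nil.1 hη, h]⟩
    · exact ⟨0, fun η hη => by simp [List.prefix_nil.1 hη, h]⟩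
  | append_singleton ν k ih =>
    by_cases h : ν ++ [k] ∈ T
    · exact ⟨ν.length + 2, fun η hη => by
        have := hη.length_le
        simp only [List.length_append, List.length_singleton] at this
        simp only [hT hη h, true_iff]
        omega⟩
    · obtain ⟨n, hn⟩ := ih
      refine ⟨min n (ν.length + 1), fun η hη => ?_⟩
      rcases List.prefix_concat_iff.1 hη with rfl | h'
      · simp [h]
      · have := h'.length_le
        rw [hn η h']
        omega

/-! ### Coordinate restrictions of finitely supported vectors. -/

section Restriction

variable {𝕜 : Type*} [RCLike 𝕜]

theorem TreeVec.linearMap_ext {M : Type*} [AddCommMonoid M] [Module 𝕜 M]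
    {A B : TreeVec 𝕜 →ₗ[𝕜] M} (h : ∀ η, A (Finsupp.single η 1) = B (Finsupp.single η 1)) :
    A = B := by
  ext η
  simpa using h η

/-- Restriction of a finitely supported vector to a set of indices. -/
noncomputable def restr (S : Set (List ℕ)) : TreeVec 𝕜 →ₗ[𝕜] TreeVec 𝕜 :=
  Finsupp.linearCombination 𝕜 (S.indicator fun η => Finsupp.single η (1 : 𝕜))

theorem restr_single (S : Set (List ℕ)) (η : List ℕ) :
    restr S (Finsupp.single η (1 : 𝕜)) = S.indicator (fun η => Finsupp.single η (1 : 𝕜)) η := by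
  simp [restr]

theorem restr_single_of_mem {S : Set (List ℕ)} {η : List ℕ} (h : η ∈ S) :
    restr S (Finsupp.single η (1 : 𝕜)) = Finsupp.single η (1 : 𝕜) := by
  simp [restr_single, h]

theorem restr_single_of_notMem {S : Set (List ℕ)} {η : List ℕ} (h : η ∉ S) :
    restr S (Finsupp.single η (1 : 𝕜)) = 0 := by
  simp [restr_single, h]

theorem restr_restr (S T : Set (List ℕ)) (v : TreeVec 𝕜) :
    restr S (restr T v) = restr (S ∩ T) v := by
  refine LinearMap.congr_fun (f := (restr S).comp (restr T)) (TreeVec.linearMap_ext fun η => ?_) v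
  by_cases hT : η ∈ T <;> by_cases hS : η ∈ S <;> simp [restr_single, hT, hS]

theorem restr_univ (v : TreeVec 𝕜) : restr Set.univ v = v :=
  LinearMap.congr_fun (g := LinearMap.id) (TreeVec.linearMap_ext fun η => by
    simp [restr_single]) v

theorem restr_union {S T : Set (List ℕ)} (h : Disjoint S T) (v : TreeVec 𝕜) :
    restr (S ∪ T) v = restr S v + restr T v := by
  refine LinearMap.congr_fun (g := restr S + restr T) (TreeVec.linearMap_ext fun η => ?_) v
  by_cases hT : η ∈ T
  · simp [restr_single, hT, Set.disjoint_right.1 h hT]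
  · by_cases hS : η ∈ S <;> simp [restr_single, hT, hS]

theorem restr_finset (A : Finset (List ℕ)) (v : TreeVec 𝕜) :
    restr (A : Set (List ℕ)) v = ∑ η ∈ A, v η • Finsupp.single η (1 : 𝕜) := by
  classical
  have : restr (𝕜 := 𝕜) (A : Set (List ℕ)) =
      ∑ η ∈ A, (Finsupp.lapply η).smulRight (Finsupp.single η (1 : 𝕜)) := by
    refine TreeVec.linearMap_ext fun η => ?_
    simp [restr_single, LinearMap.sum_apply, Set.indicator_apply, Finsupp.single_apply]
  rw [this]
  simp [LinearMap.sum_apply]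

theorem restr_of_support_subset {S : Set (List ℕ)} {v : TreeVec 𝕜}
    (h : (v.support : Set (List ℕ)) ⊆ S) : restr S v = v := by
  have h1 : restr (v.support : Set (List ℕ)) v = v := by
    rw [restr_finset]
    conv_rhs => rw [← Finsupp.sum_single v]
    exact Finset.sum_congr rfl fun η _ => by simp
  conv_lhs => rw [← h1]
  rw [restr_restr, Set.inter_eq_right.2 h, h1]

theorem Seminorm.le_sum_of_single_le (p : Seminorm 𝕜 (TreeVec 𝕜)) {M : List ℕ → ℝ}
    (h : ∀ η, p (Finsupp.single η 1) ≤ M η) (v : TreeVec 𝕜) :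
    p v ≤ ∑ η ∈ v.support, ‖v η‖ * M η := by
  have hv : v = ∑ η ∈ v.support, v η • Finsupp.single η (1 : 𝕜) := by
    rw [← restr_finset, restr_of_support_subset subset_rfl]
  calc p v = p (∑ η ∈ v.support, v η • Finsupp.single η (1 : 𝕜)) := by rw [← hv]
    _ ≤ ∑ η ∈ v.support, p (v η • Finsupp.single η (1 : 𝕜)) :=
        Finset.le_sum_of_subadditive p (map_zero p).le (map_add_le_add p) _ _
    _ ≤ _ := Finset.sum_le_sum fun η _ => by
        rw [map_smul_eq_mul]
        exact mul_le_mul_of_nonneg_left (h η) (norm_nonneg _)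

end Restriction

/-! ### Branches -/

section Branch

variable {𝕜 : Type*} [RCLike 𝕜] {F : Type*} [NormedAddCommGroup F] [NormedSpace 𝕜 F]
  (f : SchauderBasis 𝕜 F)

open Classical in
/-- The map to `F` that reads a vector along the branch ending at `ν`. -/
noncomputable def branchMap (ν : List ℕ) : TreeVec 𝕜 →ₗ[𝕜] F :=
  Finsupp.linearCombination 𝕜 fun η => if η <+: ν then f η.length else 0

/-- The seminorm of `F` along the branch ending at `ν`. -/
noncomputable def branchNorm (ν : List ℕ) : Seminorm 𝕜 (TreeVec 𝕜) :=
  (normSeminorm 𝕜 F).comp (branchMap f ν)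

theorem branchNorm_apply (ν : List ℕ) (v : TreeVec 𝕜) : branchNorm f ν v = ‖branchMap f ν v‖ :=
  rfl

open Classical in
theorem branchMap_single (ν η : List ℕ) :
    branchMap f ν (Finsupp.single η 1) = if η <+: ν then f η.length else 0 := by
  simp [branchMap]

theorem branchMap_restr_prefixes {μ ν : List ℕ} (h : μ <+: ν) (v : TreeVec 𝕜) :
    branchMap f ν (restr (prefixes μ) v) = branchMap f μ v := by
  classical
  refine LinearMap.congr_fun (f := (branchMap f ν).comp (restr (prefixes μ)))
    (TreeVec.linearMap_ext fun η => ?_) v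
  by_cases hη : η <+: μ
  · simp [restr_single_of_mem (mem_prefixes.2 hη), branchMap_single, hη, hη.trans h]
  · simp [restr_single_of_notMem (mt mem_prefixes.1 hη), branchMap_single, hη]

/-- A tree meets a branch in an initial piece, so restricting to it acts on that branch as a partial
sum operator. This is how monotonicity of the basis of `F` becomes contractivity of tree
restrictions. -/
theorem exists_branchMap_restr {T : Set (List ℕ)} (hT : IsSeqTree T) (ν : List ℕ) :
    ∃ n, ∀ v, branchMap f ν (restr T v) = SchauderBasis.proj f n (branchMap f ν v) := by
  classical
  obtain ⟨n, hn⟩ := hT.exists_length ν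
  refine ⟨n, fun v => ?_⟩
  refine LinearMap.congr_fun (f := (branchMap f ν).comp (restr T))
    (g := (SchauderBasis.proj f n : F →ₗ[𝕜] F).comp (branchMap f ν))
    (TreeVec.linearMap_ext fun η => ?_) v
  rw [LinearMap.comp_apply, LinearMap.comp_apply, branchMap_single]
  by_cases hη : η <+: ν
  · rw [if_pos hη, ContinuousLinearMap.coe_coe, SchauderBasis.proj_apply_basis_mem]
    by_cases hT' : η ∈ T
    · rw [restr_single_of_mem hT', branchMap_single, if_pos hη, if_pos ((hn η hη).1 hT')]
    · rw [restr_single_of_notMem hT', if_neg (mt (hn η hη).2 hT'), map_zero]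
  · rw [if_neg hη, map_zero, restr_single]
    by_cases hT' : η ∈ T <;> simp [hT', branchMap_single, hη]

/-- The shift by one counts the empty sequence: `μ` has `μ.length + 1` initial segments. -/
theorem proj_branchMap {μ ν : List ℕ} (h : μ <+: ν) (v : TreeVec 𝕜) :
    SchauderBasis.proj f (μ.length + 1) (branchMap f ν v) = branchMap f μ v := by
  classical
  refine LinearMap.congr_fun (f := (SchauderBasis.proj f (μ.length + 1) : F →ₗ[𝕜] F).comp
    (branchMap f ν)) (TreeVec.linearMap_ext fun η => ?_) v
  rw [LinearMap.comp_apply, branchMap_single, branchMap_single]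
  by_cases hη : η <+: ν
  · rw [if_pos hη, ContinuousLinearMap.coe_coe, SchauderBasis.proj_apply_basis_mem]
    refine if_congr ⟨fun h' => ?_, fun h' => ?_⟩ rfl rfl
    · exact List.prefix_of_prefix_length_le hη h (by omega)
    · have := h'.length_le
      omega
  · rw [if_neg hη, if_neg fun h' => hη (h'.trans h), map_zero]

variable {f}

theorem norm_proj_apply_le (hf : ∀ n, ‖SchauderBasis.proj f n‖ ≤ 1) (n : ℕ) (x : F) :
    ‖SchauderBasis.proj f n x‖ ≤ ‖x‖ := by
  simpa using (SchauderBasis.proj f n).le_of_opNorm_le (hf n) x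

theorem branchNorm_mono (hf : ∀ n, ‖SchauderBasis.proj f n‖ ≤ 1) {μ ν : List ℕ} (h : μ <+: ν)
    (v : TreeVec 𝕜) : branchNorm f μ v ≤ branchNorm f ν v := by
  rw [branchNorm_apply, branchNorm_apply, ← proj_branchMap f h]
  exact norm_proj_apply_le hf _ _

end Branch

/-! ### The fixed point equation for the norms -/

section FixedPoint

variable {𝕜 : Type*} [RCLike 𝕜]

/-- The functionals `x' + ∑ α k • y' k` of the generalized `ℓ²`-sum at `ν`, where `ψ k` plays the
role of `x' + y' k`. -/
def IsTreeFunctional (N : List ℕ → Seminorm 𝕜 (TreeVec 𝕜)) (ν : List ℕ)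
    (φ : TreeVec 𝕜 →ₗ[𝕜] 𝕜) : Prop :=
  ∃ (ψ : ℕ → TreeVec 𝕜 →ₗ[𝕜] 𝕜) (α : ℕ → ℝ),
    (∀ k v, ‖ψ k v‖ ≤ N (ν ++ [k]) v) ∧
    (∀ k, 0 ≤ α k ∧ α k ≤ 1) ∧
    (∀ K : Finset ℕ, ∑ k ∈ K, α k ^ 2 ≤ 1) ∧
    (∀ k, ∀ η ∈ prefixes ν, φ (Finsupp.single η 1) = ψ k (Finsupp.single η 1)) ∧
    (∀ k η, ν ++ [k] <+: η → φ (Finsupp.single η 1) = α k * ψ k (Finsupp.single η 1)) ∧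
    (∀ η, η ∉ comparable ν → φ (Finsupp.single η 1) = 0)

/-- The seminorm at `ν` of the generalized `ℓ²`-sum of the seminorms at `ν ++ [k]`. -/
noncomputable def treeSum (N : List ℕ → Seminorm 𝕜 (TreeVec 𝕜)) (ν : List ℕ) :
    Seminorm 𝕜 (TreeVec 𝕜) :=
  ⨆ φ : {φ // IsTreeFunctional N ν φ}, (normSeminorm 𝕜 𝕜).comp φ.1

theorem IsTreeFunctional.mono {N N' : List ℕ → Seminorm 𝕜 (TreeVec 𝕜)} (h : ∀ ν, N ν ≤ N' ν)
    {ν : List ℕ} {φ : TreeVec 𝕜 →ₗ[𝕜] 𝕜} (hφ : IsTreeFunctional N ν φ) :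
    IsTreeFunctional N' ν φ := by
  obtain ⟨ψ, α, h1, h2⟩ := hφ
  exact ⟨ψ, α, fun k v => (h1 k v).trans (h _ v), h2⟩

theorem isTreeFunctional_zero (N : List ℕ → Seminorm 𝕜 (TreeVec 𝕜)) (ν : List ℕ) :
    IsTreeFunctional N ν 0 :=
  ⟨0, 0, by simp, by simp, by simp, by simp, by simp, by simp⟩

instance (N : List ℕ → Seminorm 𝕜 (TreeVec 𝕜)) (ν : List ℕ) :
    Nonempty {φ // IsTreeFunctional N ν φ} := ⟨⟨0, isTreeFunctional_zero N ν⟩⟩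

theorem IsTreeFunctional.comp_restr {N : List ℕ → Seminorm 𝕜 (TreeVec 𝕜)} {ν : List ℕ}
    {φ : TreeVec 𝕜 →ₗ[𝕜] 𝕜} (hφ : IsTreeFunctional N ν φ) {T : Set (List ℕ)}
    (hT : ∀ μ v, N μ (restr T v) ≤ N μ v) : IsTreeFunctional N ν (φ.comp (restr T)) := by
  obtain ⟨ψ, α, h1, h2, h3, h4, h5, h6⟩ := hφ
  refine ⟨fun k => (ψ k).comp (restr T), α, fun k v => (h1 k _).trans (hT _ v), h2, h3,
    fun k η hη => ?_, fun k η hη => ?_, fun η hη => ?_⟩ <;>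
  by_cases hT' : η ∈ T <;> simp only [LinearMap.comp_apply, restr_single_of_mem,
    restr_single_of_notMem, hT', not_false_eq_true, map_zero, mul_zero]
  · exact h4 k η hη
  · exact h5 k η hη
  · exact h6 η hη

variable {F : Type*} [NormedAddCommGroup F] [NormedSpace 𝕜 F] {f : SchauderBasis 𝕜 F}

variable (f) in
/-- `c` is a splitting constant of the basis `f` after `l + 1` terms. -/
def IsSplitting (l : ℕ) (c : ℝ) : Prop :=
  0 < c ∧ ∀ x : F, ‖SchauderBasis.proj f (l + 1) x‖ + c * ‖x - SchauderBasis.proj f (l + 1) x‖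
    ≤ ‖x‖

variable (f) in
/-- The properties of the norms that are inherited along the fixed point iteration. -/
structure IsBranchFamily (N : List ℕ → Seminorm 𝕜 (TreeVec 𝕜)) : Prop where
  lower : ∀ ν v, branchNorm f ν v ≤ N ν v
  upper : ∀ ν v, N ν (restr (prefixes ν) v) ≤ branchNorm f ν v
  single : ∀ ν η, N ν (Finsupp.single η 1) ≤ ‖f η.length‖
  restr_le : ∀ T, IsSeqTree T → ∀ ν v, N ν (restr T v) ≤ N ν v
  split : ∀ l c, IsSplitting f l c → ∀ ν μ, ν.length = l → ν <+: μ → ∀ v,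
    N μ (restr (prefixes ν) v) + c * N μ (v - restr (prefixes ν) v) ≤ N μ v

/-- An unbounded family of seminorms only has a default supremum. A common bound on unit vectors
excludes this, by the triangle inequality over the finite support. -/
theorem bddAbove_range_of_single_le {ι : Sort*} {p : ι → Seminorm 𝕜 (TreeVec 𝕜)}
    {M : List ℕ → ℝ} (h : ∀ i η, p i (Finsupp.single η 1) ≤ M η) : BddAbove (Set.range p) := by
  rw [Seminorm.bddAbove_range_iff]
  intro v
  refine ⟨∑ η ∈ v.support, ‖v η‖ * M η, ?_⟩
  rintro _ ⟨i, rfl⟩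
  exact (p i).le_sum_of_single_le (h i) v

theorem IsTreeFunctional.norm_single_le {N : List ℕ → Seminorm 𝕜 (TreeVec 𝕜)}
    (hN : ∀ ν η, N ν (Finsupp.single η 1) ≤ ‖f η.length‖) {ν : List ℕ}
    {φ : TreeVec 𝕜 →ₗ[𝕜] 𝕜} (hφ : IsTreeFunctional N ν φ) (η : List ℕ) :
    ‖φ (Finsupp.single η 1)‖ ≤ ‖f η.length‖ := by
  obtain ⟨ψ, α, h1, h2, h3, h4, h5, h6⟩ := hφ
  rcases List.prefix_or_concat_prefix_or_incomparable ν η with h | ⟨k, h⟩ | h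
  · rw [h4 0 η h]
    exact (h1 _ _).trans (hN _ _)
  · rw [h5 k η h, norm_mul, RCLike.norm_ofReal, abs_of_nonneg (h2 k).1]
    exact (mul_le_of_le_one_left (norm_nonneg _) (h2 k).2).trans ((h1 _ _).trans (hN _ _))
  · rw [h6 η h, norm_zero]
    exact norm_nonneg _

theorem bddAbove_treeSum {N : List ℕ → Seminorm 𝕜 (TreeVec 𝕜)}
    (hN : ∀ ν η, N ν (Finsupp.single η 1) ≤ ‖f η.length‖) (ν : List ℕ) :
    BddAbove (Set.range fun φ : {φ // IsTreeFunctional N ν φ} =>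
      (normSeminorm 𝕜 𝕜).comp φ.1) :=
  bddAbove_range_of_single_le fun φ η => φ.2.norm_single_le hN η

theorem treeSum_apply {N : List ℕ → Seminorm 𝕜 (TreeVec 𝕜)}
    (hN : ∀ ν η, N ν (Finsupp.single η 1) ≤ ‖f η.length‖) (ν : List ℕ) (v : TreeVec 𝕜) :
    treeSum N ν v = ⨆ φ : {φ // IsTreeFunctional N ν φ}, ‖φ.1 v‖ := by
  rw [treeSum, Seminorm.iSup_apply (bddAbove_treeSum hN ν)]
  rfl

theorem IsTreeFunctional.norm_le_treeSum {N : List ℕ → Seminorm 𝕜 (TreeVec 𝕜)}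
    (hN : ∀ ν η, N ν (Finsupp.single η 1) ≤ ‖f η.length‖) {ν : List ℕ}
    {φ : TreeVec 𝕜 →ₗ[𝕜] 𝕜} (hφ : IsTreeFunctional N ν φ) (v : TreeVec 𝕜) :
    ‖φ v‖ ≤ treeSum N ν v :=
  le_ciSup (bddAbove_treeSum hN ν) ⟨φ, hφ⟩ v

theorem treeSum_le {N : List ℕ → Seminorm 𝕜 (TreeVec 𝕜)}
    (hN : ∀ ν η, N ν (Finsupp.single η 1) ≤ ‖f η.length‖) {ν : List ℕ} {v : TreeVec 𝕜} {C : ℝ}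
    (h : ∀ φ, IsTreeFunctional N ν φ → ‖φ v‖ ≤ C) : treeSum N ν v ≤ C := by
  rw [treeSum_apply hN]
  exact ciSup_le fun φ => h φ.1 φ.2

theorem exists_lt_norm_of_lt_treeSum {N : List ℕ → Seminorm 𝕜 (TreeVec 𝕜)}
    (hN : ∀ ν η, N ν (Finsupp.single η 1) ≤ ‖f η.length‖) {ν : List ℕ} {v : TreeVec 𝕜} {C : ℝ}
    (h : C < treeSum N ν v) : ∃ φ, IsTreeFunctional N ν φ ∧ C < ‖φ v‖ := by
  by_contra! h'
  exact absurd (treeSum_le hN h') (not_le.2 h)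

theorem treeSum_mono {N N' : List ℕ → Seminorm 𝕜 (TreeVec 𝕜)}
    (hN : ∀ ν η, N ν (Finsupp.single η 1) ≤ ‖f η.length‖)
    (hN' : ∀ ν η, N' ν (Finsupp.single η 1) ≤ ‖f η.length‖) (h : ∀ ν, N ν ≤ N' ν) (ν : List ℕ) :
    treeSum N ν ≤ treeSum N' ν := fun _ =>
  treeSum_le hN fun _ hφ => (hφ.mono h).norm_le_treeSum hN' _

/-- A functional on the prefixes of `ν` dominated by the branch norm is admissible. -/
theorem isTreeFunctional_of_le_branchNorm (hf : ∀ n, ‖SchauderBasis.proj f n‖ ≤ 1)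
    {N : List ℕ → Seminorm 𝕜 (TreeVec 𝕜)} (hN : IsBranchFamily f N) {ν : List ℕ}
    {φ : TreeVec 𝕜 →ₗ[𝕜] 𝕜} (hφ : ∀ v, ‖φ v‖ ≤ branchNorm f ν v) : IsTreeFunctional N ν φ := by
  have h0 : ∀ η, ¬ η <+: ν → φ (Finsupp.single η 1) = 0 := fun η hη => by
    simpa [branchNorm_apply, branchMap_single, hη] using hφ (Finsupp.single η 1)
  refine ⟨fun _ => φ, 0, fun k v => ?_, by simp, by simp, fun _ _ _ => rfl, fun k η hη => ?_,
    fun η hη => h0 η fun h => hη (Or.inl h)⟩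
  · exact (hφ v).trans ((branchNorm_mono hf (List.prefix_append _ _) v).trans (hN.lower _ v))
  · rw [h0 η fun h => List.not_concat_prefix_of_prefix h hη, mul_zero]

/-- A norming functional on `F`, pulled back along the branch, is admissible with all weights zero.
-/
theorem IsBranchFamily.branchNorm_le_treeSum (hf : ∀ n, ‖SchauderBasis.proj f n‖ ≤ 1)
    {N : List ℕ → Seminorm 𝕜 (TreeVec 𝕜)} (hN : IsBranchFamily f N) (ν : List ℕ)
    (v : TreeVec 𝕜) : branchNorm f ν v ≤ treeSum N ν v := by
  obtain ⟨g, hg, hgv⟩ := exists_dual_vector'' 𝕜 (branchMap f ν v)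
  have h : IsTreeFunctional N ν ((g : F →ₗ[𝕜] 𝕜).comp (branchMap f ν)) :=
    isTreeFunctional_of_le_branchNorm hf hN fun w => by
      simpa [branchNorm_apply] using g.le_of_opNorm_le hg (branchMap f ν w)
  have := h.norm_le_treeSum hN.single v
  simpa [hgv, branchNorm_apply] using this

theorem restr_single_eq_or (S : Set (List ℕ)) (η : List ℕ) :
    restr S (Finsupp.single η (1 : 𝕜)) = Finsupp.single η 1 ∨
      restr S (Finsupp.single η (1 : 𝕜)) = 0 := by
  by_cases h : η ∈ S
  · exact Or.inl (restr_single_of_mem h)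
  · exact Or.inr (restr_single_of_notMem h)

/-- Weights matter only above `μ`, where the restriction to `prefixes ν` vanishes and only `φ'`
contributes; so the combination can carry the weights of `φ'`. Its components are dominated by the
splitting inequality at `μ ++ [k]`, which is why that inequality is required at every extension of
`ν` and not only at `ν`. -/
theorem IsBranchFamily.isTreeFunctional_split {N : List ℕ → Seminorm 𝕜 (TreeVec 𝕜)}
    (hN : IsBranchFamily f N) {c : ℝ} {ν μ : List ℕ} (hc : IsSplitting f ν.length c)
    (hμ : ν <+: μ) {φ φ' : TreeVec 𝕜 →ₗ[𝕜] 𝕜} (hφ : IsTreeFunctional N μ φ)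
    (hφ' : IsTreeFunctional N μ φ') {θ θ' : 𝕜} (hθ : ‖θ‖ ≤ 1) (hθ' : ‖θ'‖ ≤ 1) :
    IsTreeFunctional N μ (θ • φ.comp (restr (prefixes ν)) +
      (c * θ') • φ'.comp (LinearMap.id - restr (prefixes ν))) := by
  obtain ⟨ψ, α, h1, h2, h3, h4, h5, h6⟩ := hφ
  obtain ⟨ψ', α', h1', h2', h3', h4', h5', h6'⟩ := hφ'
  refine ⟨fun k => θ • (ψ k).comp (restr (prefixes ν)) +
      (c * θ') • (ψ' k).comp (LinearMap.id - restr (prefixes ν)), α', fun k v => ?_, h2', h3',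
    fun k η hη => ?_, fun k η hη => ?_, fun η hη => ?_⟩
  · refine (norm_add_le _ _).trans (le_trans (add_le_add ?_ ?_)
      (hN.split _ c hc ν (μ ++ [k]) rfl (hμ.trans (List.prefix_append _ _)) v))
    · rw [LinearMap.smul_apply, norm_smul]
      exact (mul_le_of_le_one_left (norm_nonneg _) hθ).trans (h1 k _)
    · rw [LinearMap.smul_apply, norm_smul, norm_mul, RCLike.norm_ofReal, abs_of_pos hc.1, mul_assoc]
      exact mul_le_mul_of_nonneg_left ((mul_le_of_le_one_left (norm_nonneg _) hθ').trans (h1' k _))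
        hc.1.le
  · have a1 := h4 k η hη
    have a2 := h4' k η hη
    rcases restr_single_eq_or (𝕜 := 𝕜) (prefixes ν) η with h | h <;> simp [h, a1, a2]
  · have : restr (prefixes ν) (Finsupp.single η (1 : 𝕜)) = 0 := restr_single_of_notMem fun h =>
      List.not_concat_prefix_of_prefix (List.IsPrefix.trans h hμ) hη
    simp [this, h5' k η hη]
    ring
  · have : restr (prefixes ν) (Finsupp.single η (1 : 𝕜)) = 0 := restr_single_of_notMem fun h =>
      hη (Or.inl (List.IsPrefix.trans h hμ))
    simp [this, h6' η hη]

theorem exists_norm_le_one_mul_eq_norm (z : 𝕜) : ∃ θ : 𝕜, ‖θ‖ ≤ 1 ∧ θ * z = (‖z‖ : 𝕜) := by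
  obtain ⟨g, hg, hgz⟩ := exists_dual_vector'' 𝕜 z
  refine ⟨g 1, by simpa using g.le_of_opNorm_le hg 1, ?_⟩
  rw [← hgz, mul_comm, ← smul_eq_mul, ← map_smul, smul_eq_mul, mul_one]

theorem IsBranchFamily.isBranchFamily_treeSum (hf : ∀ n, ‖SchauderBasis.proj f n‖ ≤ 1)
    {N : List ℕ → Seminorm 𝕜 (TreeVec 𝕜)} (hN : IsBranchFamily f N) :
    IsBranchFamily f (treeSum N) where
  lower := hN.branchNorm_le_treeSum hf
  upper ν v := treeSum_le hN.single fun φ hφ => by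
    obtain ⟨ψ, α, h1, h2, h3, h4, h5, h6⟩ := hφ
    have hψ : φ.comp (restr (prefixes ν)) = (ψ 0).comp (restr (prefixes ν)) :=
      TreeVec.linearMap_ext fun η => by
        by_cases hη : η ∈ prefixes ν
        · simp [restr_single_of_mem hη, h4 0 η hη]
        · simp [restr_single_of_notMem hη]
    have h7 : restr (prefixes ν) v = restr (prefixes (ν ++ [0])) (restr (prefixes ν) v) := by
      rw [restr_restr, Set.inter_eq_right.2]
      exact fun η hη => List.IsPrefix.trans hη (List.prefix_append _ _)
    calc ‖φ (restr (prefixes ν) v)‖ = ‖ψ 0 (restr (prefixes ν) v)‖ := by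
          rw [← LinearMap.comp_apply, hψ, LinearMap.comp_apply]
      _ ≤ N (ν ++ [0]) (restr (prefixes ν) v) := h1 0 _
      _ ≤ branchNorm f (ν ++ [0]) (restr (prefixes ν) v) := by
          conv_lhs => rw [h7]
          exact hN.upper _ _
      _ = branchNorm f ν v := by
          rw [branchNorm_apply, branchMap_restr_prefixes f (List.prefix_append _ _),
            branchNorm_apply]
  single ν η := treeSum_le hN.single fun φ hφ => hφ.norm_single_le hN.single η
  restr_le T hT ν v := treeSum_le hN.single fun φ hφ =>
    (hφ.comp_restr (hN.restr_le T hT)).norm_le_treeSum hN.single v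
  split l c hc ν μ hl hμ v := by
    subst hl
    have hc0 := hc.1
    refine le_of_forall_pos_le_add fun ε hε => ?_
    -- Two functionals are norming up to `δ`, and the second one enters with the factor `c`.
    obtain ⟨δ, hδ, hδε⟩ : ∃ δ > 0, (1 + c) * δ ≤ ε := ⟨ε / (1 + c), by positivity, by
      rw [mul_div_cancel₀ _ (by positivity)]⟩
    obtain ⟨φ, hφ, h⟩ := exists_lt_norm_of_lt_treeSum hN.single
      (sub_lt_self (treeSum N μ (restr (prefixes ν) v)) hδ)
    obtain ⟨φ', hφ', h'⟩ := exists_lt_norm_of_lt_treeSum hN.single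
      (sub_lt_self (treeSum N μ (v - restr (prefixes ν) v)) hδ)
    -- Scalars rotate both values to nonnegative reals, so that nothing cancels in the combined
    -- functional.
    obtain ⟨θ, hθ, hθz⟩ := exists_norm_le_one_mul_eq_norm (φ (restr (prefixes ν) v))
    obtain ⟨θ', hθ', hθz'⟩ := exists_norm_le_one_mul_eq_norm (φ' (v - restr (prefixes ν) v))
    have key := (hN.isTreeFunctional_split hc hμ hφ hφ' hθ hθ').norm_le_treeSum hN.single v
    have e : (θ • φ.comp (restr (prefixes ν)) +
        (c * θ') • φ'.comp (LinearMap.id - restr (prefixes ν)) : TreeVec 𝕜 →ₗ[𝕜] 𝕜) v =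
        ((‖φ (restr (prefixes ν) v)‖ + c * ‖φ' (v - restr (prefixes ν) v)‖ : ℝ) : 𝕜) := by
      rw [LinearMap.add_apply, LinearMap.smul_apply, LinearMap.smul_apply, LinearMap.comp_apply,
        LinearMap.comp_apply, LinearMap.sub_apply, LinearMap.id_apply, smul_eq_mul, smul_eq_mul,
        mul_assoc, hθz, hθz']
      push_cast
      rfl
    rw [e, RCLike.norm_ofReal, abs_of_nonneg (by positivity)] at key
    nlinarith [mul_lt_mul_of_pos_left h' hc0]

theorem isBranchFamily_branchNorm (hf : ∀ n, ‖SchauderBasis.proj f n‖ ≤ 1) :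
    IsBranchFamily f (branchNorm f) where
  lower _ _ := le_rfl
  upper ν v := by
    rw [branchNorm_apply, branchMap_restr_prefixes f List.prefix_rfl, branchNorm_apply]
  single ν η := by
    classical
    rw [branchNorm_apply, branchMap_single]
    split_ifs <;> simp
  restr_le T hT ν v := by
    obtain ⟨n, hn⟩ := exists_branchMap_restr f hT ν
    rw [branchNorm_apply, hn]
    exact norm_proj_apply_le hf _ _
  split l c hc ν μ hl hμ v := by
    subst hl
    have := hc.2 (branchMap f μ v)
    rwa [proj_branchMap f hμ, ← branchMap_restr_prefixes f hμ, ← map_sub] at this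

/-- The fixed point of `treeSum` in the class of branch families. -/
theorem exists_isBranchFamily_treeSum_eq (hf : ∀ n, ‖SchauderBasis.proj f n‖ ≤ 1) :
    ∃ N : List ℕ → Seminorm 𝕜 (TreeVec 𝕜), IsBranchFamily f N ∧ treeSum N = N := by
  -- As in the Knaster–Tarski theorem, the fixed point is the supremum of all subsolutions in the
  -- class.
  let S := {M : List ℕ → Seminorm 𝕜 (TreeVec 𝕜) //
    IsBranchFamily f M ∧ ∀ ν, M ν ≤ treeSum M ν}
  let M₀ : S := ⟨branchNorm f, isBranchFamily_branchNorm hf,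
    (isBranchFamily_branchNorm hf).branchNorm_le_treeSum hf⟩
  have : Nonempty S := ⟨M₀⟩
  have hbdd : ∀ ν, BddAbove (Set.range fun M : S => M.1 ν) := fun ν =>
    bddAbove_range_of_single_le fun M η => M.2.1.single ν η
  let N : List ℕ → Seminorm 𝕜 (TreeVec 𝕜) := fun ν => ⨆ M : S, M.1 ν
  have hle : ∀ (M : S) ν, M.1 ν ≤ N ν := fun M ν =>
    le_ciSup (f := fun M : S => M.1 ν) (hbdd ν) M
  have happ : ∀ ν v, N ν v = ⨆ M : S, M.1 ν v := fun ν v => Seminorm.iSup_apply (hbdd ν)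
  have hsup : ∀ {ν v C}, (∀ M : S, M.1 ν v ≤ C) → N ν v ≤ C := fun h => by
    rw [happ]
    exact ciSup_le h
  have hN : IsBranchFamily f N :=
    { lower := fun ν v => (M₀.2.1.lower ν v).trans (hle M₀ ν v)
      upper := fun ν v => hsup fun M => M.2.1.upper ν v
      single := fun ν η => hsup fun M => M.2.1.single ν η
      restr_le := fun T hT ν v => hsup fun M => (M.2.1.restr_le T hT ν v).trans (hle M ν v)
      split := fun l c hc ν μ hl hμ v => by
        -- A supremum of sums need not be the sum of the suprema. Here the first summand is the same
        -- for every `M`, so the inequality can be solved for the second summand before the supremum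
        -- is taken.
        have h1 : ∀ M : S, M.1 μ (restr (prefixes ν) v) = branchNorm f μ (restr (prefixes ν) v) :=
          fun M => by
            refine le_antisymm ?_ (M.2.1.lower _ _)
            have h7 : restr (prefixes ν) v = restr (prefixes μ) (restr (prefixes ν) v) := by
              rw [restr_restr, Set.inter_eq_right.2]
              exact fun η hη => List.IsPrefix.trans hη hμ
            conv_lhs => rw [h7]
            exact M.2.1.upper _ _
        have h2 : N μ (restr (prefixes ν) v) ≤ branchNorm f μ (restr (prefixes ν) v) :=
          hsup fun M => (h1 M).le
        have h3 : N μ (v - restr (prefixes ν) v) ≤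
            (N μ v - branchNorm f μ (restr (prefixes ν) v)) / c := hsup fun M => by
          rw [le_div_iff₀ hc.1]
          have := M.2.1.split l c hc ν μ hl hμ v
          rw [h1] at this
          linarith [hle M μ v]
        rw [le_div_iff₀ hc.1] at h3
        linarith }
  have hNle : ∀ ν, N ν ≤ treeSum N ν := fun ν => ciSup_le (f := fun M : S => M.1 ν) fun M =>
    (M.2.2 ν).trans (treeSum_mono M.2.1.single hN.single (hle M) ν)
  refine ⟨N, hN, funext fun ν => le_antisymm ?_ (hNle ν)⟩
  -- By monotonicity `treeSum N` is again a subsolution, hence lies below the supremum `N`.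
  exact hle ⟨treeSum N, hN.isBranchFamily_treeSum hf,
    treeSum_mono hN.single (hN.isBranchFamily_treeSum hf).single hNle⟩ ν

end FixedPoint

/-! ### Compatibility of the fixed point seminorms. -/

section Consistency

variable {𝕜 : Type*} [RCLike 𝕜] {F : Type*} [NormedAddCommGroup F] [NormedSpace 𝕜 F]
  {f : SchauderBasis 𝕜 F} {N : List ℕ → Seminorm 𝕜 (TreeVec 𝕜)}

theorem IsTreeFunctional.apply_restr_comparable {ν : List ℕ} {φ : TreeVec 𝕜 →ₗ[𝕜] 𝕜}
    (hφ : IsTreeFunctional N ν φ) (v : TreeVec 𝕜) : φ (restr (comparable ν) v) = φ v := by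
  obtain ⟨ψ, α, h1, h2, h3, h4, h5, h6⟩ := hφ
  refine LinearMap.congr_fun (f := φ.comp (restr (comparable ν)))
    (TreeVec.linearMap_ext fun η => ?_) v
  by_cases hη : η ∈ comparable ν
  · simp [restr_single_of_mem hη]
  · simp [restr_single_of_notMem hη, h6 η hη]

namespace IsBranchFamily

theorem apply_restr_comparable (hN : IsBranchFamily f N) (hfix : treeSum N = N) (ν : List ℕ)
    (v : TreeVec 𝕜) : N ν (restr (comparable ν) v) = N ν v := by
  refine le_antisymm (hN.restr_le _ (isSeqTree_comparable ν) ν v) ?_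
  conv_lhs => rw [← hfix]
  refine treeSum_le hN.single fun φ hφ => ?_
  rw [← hφ.apply_restr_comparable v]
  conv_rhs => rw [← hfix]
  exact hφ.norm_le_treeSum hN.single _

/-- All the weight is put on child `k`. The other components keep only the stem part of `χ`, which
they can dominate because on the stem every seminorm of the family is the branch norm. -/
theorem isTreeFunctional_extend (hf : ∀ n, ‖SchauderBasis.proj f n‖ ≤ 1)
    (hN : IsBranchFamily f N) {ν : List ℕ} {k : ℕ} {χ : TreeVec 𝕜 →ₗ[𝕜] 𝕜}
    (hχ : ∀ v, ‖χ v‖ ≤ N (ν ++ [k]) v) :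
    IsTreeFunctional N ν (χ.comp (restr (comparable (ν ++ [k])))) := by
  classical
  refine ⟨fun j => if j = k then χ else χ.comp (restr (prefixes ν)), Pi.single k 1,
    fun j v => ?_, fun j => ?_, fun K => ?_, fun j η hη => ?_, fun j η hη => ?_, fun η hη => ?_⟩
  · rcases eq_or_ne j k with rfl | hj
    · simpa using hχ v
    · simp only [hj, if_false, LinearMap.comp_apply]
      have h : restr (prefixes ν) v = restr (prefixes (ν ++ [k])) (restr (prefixes ν) v) := by
        rw [restr_restr, Set.inter_eq_right.2]
        exact fun η hη => List.IsPrefix.trans hη (List.prefix_append _ _)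
      calc ‖χ (restr (prefixes ν) v)‖ ≤ N (ν ++ [k]) (restr (prefixes ν) v) := hχ _
        _ ≤ branchNorm f (ν ++ [k]) (restr (prefixes ν) v) := by
            conv_lhs => rw [h]
            exact hN.upper _ _
        _ = branchNorm f ν v := by
            rw [branchNorm_apply, branchMap_restr_prefixes f (List.prefix_append _ _),
              branchNorm_apply]
        _ ≤ branchNorm f (ν ++ [j]) v := branchNorm_mono hf (List.prefix_append _ _) v
        _ ≤ N (ν ++ [j]) v := hN.lower _ _
  · rcases eq_or_ne j k with rfl | hj <;> simp [*]
  · calc ∑ j ∈ K, (Pi.single k 1 : ℕ → ℝ) j ^ 2 = ∑ j ∈ K, if k = j then 1 else 0 :=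
          Finset.sum_congr rfl fun j _ => by
            rcases eq_or_ne k j with rfl | hj <;> simp [*, eq_comm]
      _ ≤ 1 := by
          rw [Finset.sum_ite_eq]
          split_ifs <;> norm_num
  · have h1 : η ∈ comparable (ν ++ [k]) := Or.inl (List.IsPrefix.trans hη (List.prefix_append _ _))
    rcases eq_or_ne j k with rfl | hj
    · simp [restr_single_of_mem h1]
    · simp [hj, restr_single_of_mem h1, restr_single_of_mem hη]
  · rcases eq_or_ne j k with rfl | hj
    · simp [restr_single_of_mem (show η ∈ comparable (ν ++ [j]) from Or.inr hη)]
    · have h1 : η ∉ comparable (ν ++ [k]) := by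
        rw [comparable_concat]
        rintro (h | h)
        · exact List.not_concat_prefix_of_prefix h hη
        · exact hj (List.eq_of_concat_prefix hη h)
      simp [hj, restr_single_of_notMem h1]
  · have h1 : η ∉ comparable (ν ++ [k]) := fun h => hη (comparable_concat_subset ν k h)
    simp [restr_single_of_notMem h1]

/-- On these vectors a tree functional at `ν` is a convex combination of `ψ k` and of `ψ k` cut off
to the stem, both bounded by `N (ν ++ [k])`. Conversely, functionals at `ν ++ [k]` extend by zero to
the other children. -/
theorem apply_restr_comparable_concat (hf : ∀ n, ‖SchauderBasis.proj f n‖ ≤ 1)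
    (hN : IsBranchFamily f N) (hfix : treeSum N = N) (ν : List ℕ) (k : ℕ)
    (v : TreeVec 𝕜) : N ν (restr (comparable (ν ++ [k])) v) = N (ν ++ [k]) v := by
  apply le_antisymm
  · conv_lhs => rw [← hfix]
    refine treeSum_le hN.single fun φ hφ => ?_
    obtain ⟨ψ, α, h1, h2, h3, h4, h5, h6⟩ := hφ
    have hdec : φ (restr (comparable (ν ++ [k])) v) =
        ((1 - α k : ℝ) : 𝕜) * ψ k (restr (prefixes ν) v) +
          (α k : 𝕜) * ψ k (restr (comparable (ν ++ [k])) v) := by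
      refine LinearMap.congr_fun (f := φ.comp (restr (comparable (ν ++ [k]))))
        (g := ((1 - α k : ℝ) : 𝕜) • (ψ k).comp (restr (prefixes ν)) +
          (α k : 𝕜) • (ψ k).comp (restr (comparable (ν ++ [k]))))
        (TreeVec.linearMap_ext fun η => ?_) v
      by_cases hη : η ∈ comparable (ν ++ [k])
      · by_cases hη' : η ∈ prefixes ν
        · simp [restr_single_of_mem hη, restr_single_of_mem hη', h4 k η hη', RCLike.real_smul_eq_coe_mul]
          ring
        · have : ν ++ [k] <+: η := by
            rw [comparable_concat] at hη
            exact hη.resolve_left hη'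
          simp [restr_single_of_mem hη, restr_single_of_notMem hη', h5 k η this,
            RCLike.real_smul_eq_coe_mul]
      · have hη' : η ∉ prefixes ν := fun h => hη (by
          rw [comparable_concat]
          exact Or.inl h)
        simp [restr_single_of_notMem hη, restr_single_of_notMem hη']
    obtain ⟨ha0, ha1⟩ := h2 k
    have i1 := (h1 k _).trans (hN.restr_le _ (isSeqTree_prefixes ν) (ν ++ [k]) v)
    have i2 := (h1 k _).trans (hN.restr_le _ (isSeqTree_comparable (ν ++ [k])) (ν ++ [k]) v)
    calc ‖φ (restr (comparable (ν ++ [k])) v)‖ ≤ (1 - α k) * N (ν ++ [k]) v +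
          α k * N (ν ++ [k]) v := by
          rw [hdec]
          refine (norm_add_le _ _).trans (add_le_add ?_ ?_)
          · rw [norm_mul, RCLike.norm_ofReal, abs_of_nonneg (by linarith)]
            exact mul_le_mul_of_nonneg_left i1 (by linarith)
          · rw [norm_mul, RCLike.norm_ofReal, abs_of_nonneg ha0]
            exact mul_le_mul_of_nonneg_left i2 ha0
      _ = N (ν ++ [k]) v := by ring
  · conv_lhs => rw [← hfix]
    refine treeSum_le hN.single fun χ hχ => ?_
    have hχ' : ∀ v, ‖χ v‖ ≤ N (ν ++ [k]) v := fun v => by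
      rw [← hfix]
      exact hχ.norm_le_treeSum hN.single v
    have := (hN.isTreeFunctional_extend hf hχ').norm_le_treeSum hN.single
      (restr (comparable (ν ++ [k])) v)
    rwa [hfix, LinearMap.comp_apply, restr_restr, Set.inter_self,
      hχ.apply_restr_comparable] at this

/-- On the vectors supported on the sequences comparable with `ν`, the norm at the root is the
norm at `ν`. -/
theorem nil_apply_restr_comparable (hf : ∀ n, ‖SchauderBasis.proj f n‖ ≤ 1)
    (hN : IsBranchFamily f N) (hfix : treeSum N = N) (ν : List ℕ) (v : TreeVec 𝕜) :
    N [] (restr (comparable ν) v) = N ν v := by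
  induction ν using List.reverseRecOn generalizing v with
  | nil => rw [comparable_nil, restr_univ]
  | append_singleton ν k ih =>
    rw [← hN.apply_restr_comparable_concat hf hfix, ← ih, restr_restr,
      Set.inter_eq_right.2 (comparable_concat_subset ν k)]

end IsBranchFamily

end Consistency

/-! ### Completion, and cofinality of finite trees. -/

theorem Seminorm.exists_completion {𝕜 V : Type u} [RCLike 𝕜] [AddCommGroup V] [Module 𝕜 V]
    (p : Seminorm 𝕜 V) :
    ∃ (E : Type u) (_ : NormedAddCommGroup E) (_ : NormedSpace 𝕜 E) (_ : CompleteSpace E)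
      (ι : V →ₗ[𝕜] E), DenseRange ι ∧ ∀ v, ‖ι v‖ = p v := by
  let : SeminormedAddCommGroup V := p.toAddGroupSeminorm.toSeminormedAddCommGroup
  let : NormedSpace 𝕜 V := ⟨fun c v => (map_smul_eq_mul p c v).le⟩
  exact ⟨UniformSpace.Completion V, inferInstance, inferInstance, inferInstance,
    (UniformSpace.Completion.toComplₗᵢ (𝕜 := 𝕜) (E := V)).toLinearMap,
    UniformSpace.Completion.denseRange_coe, fun v => UniformSpace.Completion.norm_coe v⟩

theorem eventually_mem_finiteTree (η : List ℕ) :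
    ∀ᶠ T in (atTop : Filter {T : Finset (List ℕ) // IsSeqTree (T : Set (List ℕ))}), η ∈ T.1 := by
  have hT : IsSeqTree ((η.inits.toFinset : Finset (List ℕ)) : Set (List ℕ)) := by
    intro μ ν h h'
    simp only [Finset.mem_coe, List.mem_toFinset, List.mem_inits] at h' ⊢
    exact h.trans h'
  have : Nonempty {T : Finset (List ℕ) // IsSeqTree (T : Set (List ℕ))} := ⟨⟨_, hT⟩⟩
  filter_upwards [eventually_ge_atTop ⟨_, hT⟩] with T h
  exact h (by simp)

/-! ### Closed spans -/

section ClosedSpan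

variable {𝕜 : Type*} [RCLike 𝕜] {E : Type*} [NormedAddCommGroup E] [NormedSpace 𝕜 E]

theorem map_mem_of_mem_closedSpan {G : Type*} [NormedAddCommGroup G] [NormedSpace 𝕜 G]
    {e : List ℕ → E} {S : Set (List ℕ)} {A : E →L[𝕜] G} {W : Submodule 𝕜 G}
    (hW : IsClosed (W : Set G)) (h : ∀ η ∈ S, A (e η) ∈ W) {x : E}
    (hx : x ∈ closedSpan (𝕜 := 𝕜) e S) : A x ∈ W := by
  have : (Submodule.span 𝕜 (e '' S)).topologicalClosure ≤ W.comap (A : E →ₗ[𝕜] G) :=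
    Submodule.topologicalClosure_minimal _ (by
      rw [Submodule.span_le]
      rintro _ ⟨η, hη, rfl⟩
      exact h η hη) (hW.preimage A.continuous)
  exact this hx

theorem isClosed_closedSpan (e : List ℕ → E) (S : Set (List ℕ)) :
    IsClosed (closedSpan (𝕜 := 𝕜) e S : Set E) :=
  Submodule.isClosed_topologicalClosure _

theorem mem_closedSpan {e : List ℕ → E} {S : Set (List ℕ)} {η : List ℕ} (h : η ∈ S) :
    e η ∈ closedSpan (𝕜 := 𝕜) e S :=
  Submodule.le_topologicalClosure _ (Submodule.subset_span ⟨η, h, rfl⟩)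

theorem closedSpan_mono (e : List ℕ → E) {S T : Set (List ℕ)} (h : S ⊆ T) :
    closedSpan (𝕜 := 𝕜) e S ≤ closedSpan e T :=
  Submodule.topologicalClosure_mono (Submodule.span_mono (Set.image_mono h))

end ClosedSpan

/-! ### The completed space -/

/-- A completion of the finitely supported vectors for the norm at the root of a fixed point of
`treeSum`. -/
structure TreeModel {𝕜 : Type*} [RCLike 𝕜] {F : Type*} [NormedAddCommGroup F] [NormedSpace 𝕜 F]
    (f : SchauderBasis 𝕜 F) (E : Type*) [NormedAddCommGroup E] [NormedSpace 𝕜 E] where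
  norm_proj_le : ∀ n, ‖SchauderBasis.proj f n‖ ≤ 1
  N : List ℕ → Seminorm 𝕜 (TreeVec 𝕜)
  isBranchFamily : IsBranchFamily f N
  treeSum_eq : treeSum N = N
  ι : TreeVec 𝕜 →ₗ[𝕜] E
  denseRange : DenseRange ι
  norm_ι : ∀ v, ‖ι v‖ = N [] v

namespace TreeModel

variable {𝕜 : Type*} [RCLike 𝕜] {F : Type*} [NormedAddCommGroup F] [NormedSpace 𝕜 F]
  {f : SchauderBasis 𝕜 F} {E : Type*} [NormedAddCommGroup E] [NormedSpace 𝕜 E]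
  (m : TreeModel f E)

theorem norm_ι_restr_comparable (ν : List ℕ) (v : TreeVec 𝕜) :
    ‖m.ι (restr (comparable ν) v)‖ = m.N ν v := by
  rw [m.norm_ι, m.isBranchFamily.nil_apply_restr_comparable m.norm_proj_le m.treeSum_eq]

theorem norm_ι_restr_le {T : Set (List ℕ)} (hT : IsSeqTree T) (v : TreeVec 𝕜) :
    ‖m.ι (restr T v)‖ ≤ ‖m.ι v‖ := by
  rw [m.norm_ι, m.norm_ι]
  exact m.isBranchFamily.restr_le T hT [] v

theorem N_le (ν : List ℕ) (v : TreeVec 𝕜) : m.N ν v ≤ ‖m.ι v‖ := by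
  rw [← m.norm_ι_restr_comparable]
  exact m.norm_ι_restr_le (isSeqTree_comparable ν) v

theorem norm_le_N {ν : List ℕ} {φ : TreeVec 𝕜 →ₗ[𝕜] 𝕜} (hφ : IsTreeFunctional m.N ν φ)
    (v : TreeVec 𝕜) : ‖φ v‖ ≤ m.N ν v := by
  conv_rhs => rw [← m.treeSum_eq]
  exact hφ.norm_le_treeSum m.isBranchFamily.single v

/-- The bounds `lower` and `upper` of a branch family coincide on the stem; this is the source of
(a). -/
theorem norm_ι_restr_prefixes (ν : List ℕ) (v : TreeVec 𝕜) :
    ‖m.ι (restr (prefixes ν) v)‖ = ‖branchMap f ν v‖ := by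
  have h : restr (prefixes ν) v = restr (comparable ν) (restr (prefixes ν) v) := by
    rw [restr_restr, Set.inter_eq_right.2]
    exact fun η hη => Or.inl hη
  rw [h, m.norm_ι_restr_comparable]
  refine le_antisymm (m.isBranchFamily.upper ν v) ?_
  have := m.isBranchFamily.lower ν (restr (prefixes ν) v)
  rwa [branchNorm_apply, branchMap_restr_prefixes f List.prefix_rfl] at this

/-- The basis vectors. -/
noncomputable def vec (η : List ℕ) : E := m.ι (Finsupp.single η 1)

theorem norm_vec (η : List ℕ) : ‖m.vec η‖ = ‖f η.length‖ := by
  have := m.norm_ι_restr_prefixes η (Finsupp.single η 1)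
  rw [restr_single_of_mem (mem_prefixes.2 List.prefix_rfl)] at this
  rw [vec, this, branchMap_single, if_pos List.prefix_rfl]

theorem vec_ne_zero (η : List ℕ) : m.vec η ≠ 0 := by
  rw [← norm_pos_iff, m.norm_vec, norm_pos_iff]
  exact f.linearIndependent.ne_zero _

/-- Removing the endpoint `η` from its branch leaves a tree, so a single coordinate is the
difference of two contractive restrictions; hence the factor `2`. -/
theorem norm_apply_le (η : List ℕ) (v : TreeVec 𝕜) :
    ‖v η‖ ≤ 2 / ‖m.vec η‖ * ‖m.ι v‖ := by
  have hT : IsSeqTree (prefixes η \ {η}) := by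
    rintro μ ν h ⟨h1, h2⟩
    refine ⟨h.trans h1, fun h3 => h2 ?_⟩
    rw [Set.mem_singleton_iff] at h3 ⊢
    subst h3
    exact h1.eq_of_length_le h.length_le
  have h1 : restr (prefixes η) v = restr (prefixes η \ {η}) v + v η • Finsupp.single η (1 : 𝕜) := by
    conv_lhs => rw [← Set.sdiff_union_of_subset
      (Set.singleton_subset_iff.2 (mem_prefixes.2 (List.prefix_refl η))),
      restr_union Set.disjoint_sdiff_left]
    congr 1
    simpa using restr_finset {η} v
  have h2 : v η • m.vec η = m.ι (restr (prefixes η) v) - m.ι (restr (prefixes η \ {η}) v) := by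
    rw [h1, map_add, map_smul, vec]
    abel
  have h3 : ‖v η‖ * ‖m.vec η‖ ≤ 2 * ‖m.ι v‖ := by
    rw [← norm_smul, h2]
    refine (norm_sub_le _ _).trans ?_
    linarith [m.norm_ι_restr_le (isSeqTree_prefixes η) v, m.norm_ι_restr_le hT v]
  rw [div_mul_eq_mul_div, le_div_iff₀ (norm_pos_iff.2 (m.vec_ne_zero η))]
  exact h3

/-- The coordinate functionals. -/
noncomputable def coord (η : List ℕ) : StrongDual 𝕜 E :=
  (Finsupp.lapply η : TreeVec 𝕜 →ₗ[𝕜] 𝕜).extendOfNorm m.ι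

theorem coord_ι (η : List ℕ) (v : TreeVec 𝕜) : m.coord η (m.ι v) = v η :=
  LinearMap.extendOfNorm_eq m.denseRange ⟨_, m.norm_apply_le η⟩ v

theorem coord_vec (η ν : List ℕ) : m.coord η (m.vec ν) = (Finsupp.single ν (1 : 𝕜)) η :=
  m.coord_ι η _

theorem ext_vec {G : Type*} [NormedAddCommGroup G] [NormedSpace 𝕜 G] {A B : E →L[𝕜] G}
    (h : ∀ η, A (m.vec η) = B (m.vec η)) : A = B := by
  have h1 : (A : E →ₗ[𝕜] G).comp m.ι = (B : E →ₗ[𝕜] G).comp m.ι := TreeVec.linearMap_ext h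
  ext x
  exact congr_fun (m.denseRange.equalizer A.continuous B.continuous
    (funext fun v => LinearMap.congr_fun h1 v)) x

/-- A bounded net of operators that converges on the basis converges pointwise. -/
theorem tendsto_of_tendsto_vec {α : Type*} {l : Filter α} {G : Type*} [NormedAddCommGroup G]
    [NormedSpace 𝕜 G] {A : α → E →L[𝕜] G} {B : E →L[𝕜] G} {C : ℝ}
    (hA : ∀ i x, ‖A i x‖ ≤ C * ‖x‖)
    (h : ∀ η, Tendsto (fun i => A i (m.vec η)) l (𝓝 (B (m.vec η)))) (x : E) :
    Tendsto (fun i => A i x) l (𝓝 (B x)) := by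
  have hv : ∀ v, Tendsto (fun i => A i (m.ι v)) l (𝓝 (B (m.ι v))) := fun v => by
    induction v using Finsupp.induction_linear with
    | zero => simpa using tendsto_const_nhds
    | add v w hv hw => simpa using hv.add hw
    | single η a =>
      have : Finsupp.single η a = a • Finsupp.single η (1 : 𝕜) := by simp
      rw [this, map_smul, map_smul]
      simp only [map_smul]
      exact (h η).const_smul a
  rw [Metric.tendsto_nhds]
  intro ε hε
  obtain ⟨δ, hδ, hδε⟩ : ∃ δ > 0, (|C| + ‖B‖ + 1) * δ < ε :=
    ⟨ε / (2 * (|C| + ‖B‖ + 1)), by positivity, by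
      have : 0 < |C| + ‖B‖ + 1 := by positivity
      field_simp
      linarith⟩
  obtain ⟨v, hvx⟩ := m.denseRange.exists_dist_lt x hδ
  rw [dist_eq_norm] at hvx
  filter_upwards [Metric.tendsto_nhds.1 (hv v) δ hδ] with i hi
  rw [dist_eq_norm] at hi ⊢
  have h1 : ‖A i (x - m.ι v)‖ ≤ |C| * δ := (hA i _).trans
    (mul_le_mul (le_abs_self C) hvx.le (norm_nonneg _) (abs_nonneg C))
  have h2 : ‖B (x - m.ι v)‖ ≤ ‖B‖ * δ := B.le_opNorm_of_le hvx.le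
  have h3 : A i x - B x = A i (x - m.ι v) + (A i (m.ι v) - B (m.ι v)) - B (x - m.ι v) := by
    simp only [map_sub]
    abel
  calc ‖A i x - B x‖ ≤ ‖A i (x - m.ι v)‖ + ‖A i (m.ι v) - B (m.ι v)‖ + ‖B (x - m.ι v)‖ := by
        rw [h3]
        exact (norm_sub_le _ _).trans (add_le_add_left (norm_add_le _ _) _)
    _ ≤ |C| * δ + δ + ‖B‖ * δ := by linarith
    _ = (|C| + ‖B‖ + 1) * δ := by ring
    _ < ε := hδε

theorem apply_eq_of_mem_closedSpan {G : Type*} [NormedAddCommGroup G] [NormedSpace 𝕜 G]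
    {S : Set (List ℕ)} {A B : E →L[𝕜] G}
    (h : ∀ η ∈ S, A (m.vec η) = B (m.vec η)) {x : E}
    (hx : x ∈ closedSpan (𝕜 := 𝕜) m.vec S) : A x = B x := by
  have := map_mem_of_mem_closedSpan (A := A - B) (W := ⊥) (by simp)
    (fun η hη => by simp [h η hη]) hx
  simpa [sub_eq_zero] using this

theorem apply_mem_closedSpan {S : Set (List ℕ)} {A : E →L[𝕜] E}
    (h : ∀ η, A (m.vec η) ∈ closedSpan (𝕜 := 𝕜) m.vec S) (x : E) :
    A x ∈ closedSpan (𝕜 := 𝕜) m.vec S := by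
  have hx : x ∈ closedSpan (𝕜 := 𝕜) m.vec Set.univ := by
    refine (isClosed_closedSpan m.vec Set.univ).closure_subset_iff.2 ?_ (m.denseRange x)
    rintro _ ⟨v, rfl⟩
    have : ∀ v, m.ι v ∈ closedSpan (𝕜 := 𝕜) m.vec Set.univ := fun v => by
      induction v using Finsupp.induction_linear with
      | zero => simp
      | add v w hv hw => simpa using add_mem hv hw
      | single η a =>
        have : Finsupp.single η a = a • Finsupp.single η (1 : 𝕜) := by simp
        rw [this, map_smul]
        exact Submodule.smul_mem _ _ (mem_closedSpan (e := m.vec) (Set.mem_univ η))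
    exact this v
  exact map_mem_of_mem_closedSpan (isClosed_closedSpan m.vec S) (fun η _ => h η) hx

theorem norm_sum_take (ν : List ℕ) (r : ℕ → 𝕜) :
    ‖∑ i ∈ Finset.range (ν.length + 1), r i • m.vec (ν.take i)‖ =
      ‖∑ i ∈ Finset.range (ν.length + 1), r i • f i‖ := by
  let v : TreeVec 𝕜 :=
    ∑ i ∈ Finset.range (ν.length + 1), r i • Finsupp.single (ν.take i) (1 : 𝕜)
  have h1 : restr (prefixes ν) v = v := by
    simp only [v, map_sum, map_smul]
    exact Finset.sum_congr rfl fun i _ => by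
      rw [restr_single_of_mem (mem_prefixes.2 (List.take_prefix i ν))]
  have h2 : branchMap f ν v = ∑ i ∈ Finset.range (ν.length + 1), r i • f i := by
    simp only [v, map_sum, map_smul]
    refine Finset.sum_congr rfl fun i hi => ?_
    rw [branchMap_single, if_pos (List.take_prefix i ν), List.length_take, min_eq_left]
    exact Nat.lt_succ_iff.1 (Finset.mem_range.1 hi)
  have h3 := m.norm_ι_restr_prefixes ν v
  rw [h1, h2] at h3
  rw [← h3]
  simp only [v, map_sum, map_smul, vec]

/-! ### Tree projections and the basis expansion. -/

variable [CompleteSpace E]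

/-- The projection onto a tree (meaningful only for trees). -/
noncomputable def treeProj (T : Set (List ℕ)) : E →L[𝕜] E :=
  (m.ι.comp (restr T)).extendOfNorm m.ι

section TreeProj

variable {T : Set (List ℕ)}

theorem treeProj_ι (hT : IsSeqTree T) (v : TreeVec 𝕜) : m.treeProj T (m.ι v) = m.ι (restr T v) :=
  LinearMap.extendOfNorm_eq m.denseRange
    ⟨1, fun v => by simpa using m.norm_ι_restr_le hT v⟩ v

theorem norm_treeProj_apply_le (hT : IsSeqTree T) (x : E) : ‖m.treeProj T x‖ ≤ ‖x‖ := by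
  have := LinearMap.norm_extendOfNorm_apply_le (f := m.ι.comp (restr T)) m.denseRange 1
    (fun v => by simpa using m.norm_ι_restr_le hT v) x
  rwa [one_mul] at this

theorem treeProj_vec_of_mem (hT : IsSeqTree T) {η : List ℕ} (hη : η ∈ T) :
    m.treeProj T (m.vec η) = m.vec η := by
  rw [vec, m.treeProj_ι hT, restr_single_of_mem hη]

theorem treeProj_vec_of_notMem (hT : IsSeqTree T) {η : List ℕ} (hη : η ∉ T) :
    m.treeProj T (m.vec η) = 0 := by
  rw [vec, m.treeProj_ι hT, restr_single_of_notMem hη, map_zero]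

theorem sum_coord_smul_vec {A : Finset (List ℕ)} (hA : IsSeqTree (A : Set (List ℕ))) (x : E) :
    ∑ η ∈ A, m.coord η x • m.vec η = m.treeProj A x := by
  have : ∑ η ∈ A, (m.coord η).smulRight (m.vec η) = m.treeProj A := by
    refine m.ext_vec fun ν => ?_
    rw [vec, m.treeProj_ι hA, restr_finset, map_sum]
    simp only [_root_.sum_apply, ContinuousLinearMap.smulRight_apply, coord_ι,
      map_smul]
    rfl
  rw [← this]
  simp

end TreeProj

/-- Partial sums over finite trees are tree projections, hence contractions, and each basis vector
is eventually fixed. Boundedness then gives convergence everywhere. -/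
theorem hasSum_coord (x : E) : HasSum (fun η => m.coord η x • m.vec η) x finiteTrees := by
  rw [HasSum, finiteTrees, tendsto_map'_iff]
  have h : ∀ T : {T : Finset (List ℕ) // IsSeqTree (T : Set (List ℕ))},
      ((fun s : Finset (List ℕ) => ∑ η ∈ s, m.coord η x • m.vec η) ∘ Subtype.val) T =
        m.treeProj T.1 x := fun T => m.sum_coord_smul_vec T.2 x
  rw [funext h]
  refine m.tendsto_of_tendsto_vec (B := ContinuousLinearMap.id 𝕜 E) (C := 1)
    (fun T x => by simpa using m.norm_treeProj_apply_le T.2 x) (fun η => ?_) x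
  refine tendsto_const_nhds.congr' ?_
  filter_upwards [eventually_mem_finiteTree η] with T hT
  rw [m.treeProj_vec_of_mem T.2 hT, ContinuousLinearMap.id_apply]

/-- The basis of the completed space. -/
noncomputable def basis : GeneralSchauderBasis (List ℕ) 𝕜 E finiteTrees where
  basis := m.vec
  coord := m.coord
  ortho i j := by
    rw [m.coord_vec]
    rcases eq_or_ne i j with rfl | h
    · simp
    · simp [Finsupp.single_eq_of_ne h, h]
  expansion := m.hasSum_coord

theorem coord_treeProj {T : Set (List ℕ)} (hT : IsSeqTree T) (η : List ℕ) (x : E) :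
    m.coord η (m.treeProj T x) = T.indicator (fun η => m.coord η x) η := by
  classical
  by_cases hη : η ∈ T
  · rw [Set.indicator_of_mem hη]
    refine DFunLike.congr_fun (F := StrongDual 𝕜 E) (f := (m.coord η).comp (m.treeProj T))
      (m.ext_vec fun ν => ?_) x
    rw [ContinuousLinearMap.comp_apply]
    by_cases hν : ν ∈ T
    · rw [m.treeProj_vec_of_mem hT hν]
    · rw [m.treeProj_vec_of_notMem hT hν, map_zero, m.coord_vec, Finsupp.single_apply, if_neg]
      rintro rfl
      exact hν hη
  · rw [Set.indicator_of_notMem hη]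
    refine DFunLike.congr_fun (F := StrongDual 𝕜 E) (f := (m.coord η).comp (m.treeProj T)) (g := 0)
      (m.ext_vec fun ν => ?_) x
    rw [ContinuousLinearMap.comp_apply]
    by_cases hν : ν ∈ T
    · rw [m.treeProj_vec_of_mem hT hν, m.coord_vec, Finsupp.single_apply, if_neg]
      · rfl
      rintro rfl
      exact hη hν
    · rw [m.treeProj_vec_of_notMem hT hν, map_zero]
      rfl

theorem hasSum_treeProj {T : Set (List ℕ)} (hT : IsSeqTree T) (x : E) :
    HasSum (T.indicator fun η => m.coord η x • m.vec η) (m.treeProj T x) finiteTrees := by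
  have : (T.indicator fun η => m.coord η x • m.vec η) =
      fun η => m.coord η (m.treeProj T x) • m.vec η := by
    funext η
    rw [m.coord_treeProj hT]
    by_cases hη : η ∈ T <;> simp [hη]
  rw [this]
  exact m.hasSum_coord _

theorem treeProj_eq_self {T : Set (List ℕ)} (hT : IsSeqTree T) {x : E}
    (hx : x ∈ closedSpan (𝕜 := 𝕜) m.vec T) : m.treeProj T x = x :=
  m.apply_eq_of_mem_closedSpan (B := ContinuousLinearMap.id 𝕜 E)
    (fun _ hη => m.treeProj_vec_of_mem hT hη) hx

theorem treeProj_mem {T : Set (List ℕ)} (hT : IsSeqTree T) (x : E) :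
    m.treeProj T x ∈ closedSpan (𝕜 := 𝕜) m.vec T :=
  m.apply_mem_closedSpan (fun η => by
    by_cases hη : η ∈ T
    · rw [m.treeProj_vec_of_mem hT hη]
      exact mem_closedSpan hη
    · rw [m.treeProj_vec_of_notMem hT hη]
      exact zero_mem _) x

theorem norm_treeProj_split {ν : List ℕ} {c : ℝ} (hc : IsSplitting f ν.length c) (x : E) :
    ‖m.treeProj (prefixes ν) x‖ + c * ‖m.treeProj (comparable ν) x - m.treeProj (prefixes ν) x‖ ≤
      ‖m.treeProj (comparable ν) x‖ := by
  refine m.denseRange.induction_on (p := fun x => ‖m.treeProj (prefixes ν) x‖ +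
    c * ‖m.treeProj (comparable ν) x - m.treeProj (prefixes ν) x‖ ≤
      ‖m.treeProj (comparable ν) x‖) x (isClosed_le (by fun_prop) (by fun_prop)) fun v => ?_
  have hsub : restr (prefixes ν) v = restr (comparable ν) (restr (prefixes ν) v) := by
    rw [restr_restr, Set.inter_eq_right.2]
    exact fun η hη => Or.inl hη
  have := m.isBranchFamily.split ν.length c hc ν ν rfl List.prefix_rfl v
  rw [m.treeProj_ι (isSeqTree_prefixes ν), m.treeProj_ι (isSeqTree_comparable ν)]
  conv_lhs => rw [hsub, ← map_sub, ← map_sub]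
  simpa only [m.norm_ι_restr_comparable] using this

end TreeModel

/-! ### The generalized `ℓ²`-sums -/

namespace TreeModel

variable {𝕜 : Type*} [RCLike 𝕜] {F : Type*} [NormedAddCommGroup F] [NormedSpace 𝕜 F]
  {f : SchauderBasis 𝕜 F} {E : Type*} [NormedAddCommGroup E] [NormedSpace 𝕜 E]
  (m : TreeModel f E)

/-- The span of the vectors along the branch ending at `ν`. -/
noncomputable abbrev stem (ν : List ℕ) : Submodule 𝕜 E := closedSpan m.vec (prefixes ν)

/-- The closed span of the vectors above `ν ++ [k]`. -/
noncomputable abbrev child (ν : List ℕ) (k : ℕ) : Submodule 𝕜 E := closedSpan m.vec {η | ν ++ [k] <+: η}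

variable [CompleteSpace E]

/-- The projection onto `child ν k`. -/
noncomputable def childProj (ν : List ℕ) (k : ℕ) : E →L[𝕜] E :=
  m.treeProj (comparable (ν ++ [k])) - m.treeProj (prefixes ν)

theorem childProj_apply (ν : List ℕ) (k : ℕ) (x : E) : m.childProj ν k x =
    m.treeProj (comparable (ν ++ [k])) x - m.treeProj (prefixes ν) x := rfl

theorem childProj_ι (ν : List ℕ) (k : ℕ) (v : TreeVec 𝕜) :
    m.childProj ν k (m.ι v) = m.ι (restr {η | ν ++ [k] <+: η} v) := by
  have hd : Disjoint (prefixes ν) {η | ν ++ [k] <+: η} :=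
    Set.disjoint_left.2 fun η h => List.not_concat_prefix_of_prefix h
  rw [childProj_apply, m.treeProj_ι (isSeqTree_comparable _), m.treeProj_ι (isSeqTree_prefixes _),
    comparable_concat, restr_union hd, map_add]
  abel

theorem childProj_vec_of_prefix {ν η : List ℕ} {k : ℕ} (h : ν ++ [k] <+: η) :
    m.childProj ν k (m.vec η) = m.vec η := by
  rw [vec, m.childProj_ι, restr_single_of_mem h]

theorem childProj_vec_of_not_prefix {ν η : List ℕ} {k : ℕ} (h : ¬ ν ++ [k] <+: η) :
    m.childProj ν k (m.vec η) = 0 := by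
  rw [vec, m.childProj_ι, restr_single_of_notMem h, map_zero]

theorem childProj_mem (ν : List ℕ) (k : ℕ) (x : E) : m.childProj ν k x ∈ m.child ν k :=
  m.apply_mem_closedSpan (fun η => by
    by_cases hη : ν ++ [k] <+: η
    · rw [m.childProj_vec_of_prefix hη]
      exact mem_closedSpan hη
    · rw [m.childProj_vec_of_not_prefix hη]
      exact zero_mem _) x

theorem stemProj_mem (ν : List ℕ) (x : E) : m.treeProj (prefixes ν) x ∈ m.stem ν :=
  m.treeProj_mem (isSeqTree_prefixes ν) x

theorem stemProj_of_mem_stem {ν : List ℕ} {x : E} (hx : x ∈ m.stem ν) :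
    m.treeProj (prefixes ν) x = x :=
  m.treeProj_eq_self (isSeqTree_prefixes ν) hx

theorem stemProj_of_mem_child {ν : List ℕ} {k : ℕ} {y : E} (hy : y ∈ m.child ν k) :
    m.treeProj (prefixes ν) y = 0 :=
  m.apply_eq_of_mem_closedSpan (B := 0) (fun _ hη => m.treeProj_vec_of_notMem
    (isSeqTree_prefixes ν) fun h => List.not_concat_prefix_of_prefix h hη) hy

theorem childProj_of_mem_stem {ν : List ℕ} (k : ℕ) {x : E} (hx : x ∈ m.stem ν) :
    m.childProj ν k x = 0 :=
  m.apply_eq_of_mem_closedSpan (B := 0) (fun _ hη => m.childProj_vec_of_not_prefix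
    (List.not_concat_prefix_of_prefix hη)) hx

theorem childProj_of_mem_child {ν : List ℕ} {k : ℕ} {y : E} (hy : y ∈ m.child ν k) :
    m.childProj ν k y = y :=
  m.apply_eq_of_mem_closedSpan (B := ContinuousLinearMap.id 𝕜 E)
    (fun _ hη => m.childProj_vec_of_prefix hη) hy

theorem childProj_of_mem_child_of_ne {ν : List ℕ} {j k : ℕ} (h : j ≠ k) {y : E}
    (hy : y ∈ m.child ν j) : m.childProj ν k y = 0 :=
  m.apply_eq_of_mem_closedSpan (B := 0) (fun _ hη => m.childProj_vec_of_not_prefix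
    fun h' => h (List.eq_of_concat_prefix hη h')) hy

/-! ### Summation over the children and the `ℓ²`-estimates. -/

theorem isSeqTree_fan (ν : List ℕ) (K : Finset ℕ) :
    IsSeqTree (prefixes ν ∪ {η | ∃ k ∈ K, ν ++ [k] <+: η}) := by
  rintro μ η h (h' | ⟨k, hk, h'⟩)
  · exact Or.inl (h.trans h')
  · have := isSeqTree_comparable (ν ++ [k]) h (Or.inr h')
    rw [comparable_concat] at this
    exact this.imp id fun h => ⟨k, hk, h⟩

theorem sum_childProj (ν : List ℕ) (K : Finset ℕ) : ∑ k ∈ K, m.childProj ν k =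
    m.treeProj (prefixes ν ∪ {η | ∃ k ∈ K, ν ++ [k] <+: η}) - m.treeProj (prefixes ν) := by
  refine m.ext_vec fun η => ?_
  have hT := isSeqTree_fan ν K
  rw [_root_.sum_apply, _root_.sub_apply]
  by_cases h : η ∈ prefixes ν
  · rw [m.treeProj_vec_of_mem hT (Or.inl h), m.treeProj_vec_of_mem (isSeqTree_prefixes ν) h,
      sub_self]
    exact Finset.sum_eq_zero fun k _ =>
      m.childProj_vec_of_not_prefix (List.not_concat_prefix_of_prefix h)
  · rw [m.treeProj_vec_of_notMem (isSeqTree_prefixes ν) h, sub_zero]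
    by_cases h' : ∃ k ∈ K, ν ++ [k] <+: η
    · rw [m.treeProj_vec_of_mem hT (Or.inr h')]
      obtain ⟨k, hk, h'⟩ := h'
      rw [Finset.sum_eq_single_of_mem k hk, m.childProj_vec_of_prefix h']
      exact fun j _ hj => m.childProj_vec_of_not_prefix fun h'' =>
        hj (List.eq_of_concat_prefix h'' h')
    · rw [m.treeProj_vec_of_notMem hT fun h'' => h''.elim h h']
      exact Finset.sum_eq_zero fun k hk =>
        m.childProj_vec_of_not_prefix fun h'' => h' ⟨k, hk, h''⟩

/-- The stem together with finitely many children is a tree, so partial sums are differences of two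
contractions, bounded by `2`; convergence need only be checked on basis vectors. -/
theorem hasSum_childProj (ν : List ℕ) (x : E) : HasSum (fun k => m.childProj ν k x)
    (m.treeProj (comparable ν) x - m.treeProj (prefixes ν) x) := by
  have h := m.tendsto_of_tendsto_vec (l := atTop) (A := fun K : Finset ℕ => ∑ k ∈ K, m.childProj ν k)
    (B := m.treeProj (comparable ν) - m.treeProj (prefixes ν)) (C := 2) (fun K y => ?_)
    (fun η => ?_) x
  · simpa [HasSum] using h
  · rw [sum_childProj, _root_.sub_apply]
    refine (norm_sub_le _ _).trans ?_
    linarith [m.norm_treeProj_apply_le (isSeqTree_fan ν K) y,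
      m.norm_treeProj_apply_le (isSeqTree_prefixes ν) y]
  · refine tendsto_const_nhds.congr' ?_
    have hc := isSeqTree_comparable ν
    rcases List.prefix_or_concat_prefix_or_incomparable ν η with h | ⟨k, h⟩ | h
    · refine Eventually.of_forall fun K => ?_
      beta_reduce
      rw [sum_childProj, _root_.sub_apply, _root_.sub_apply,
        m.treeProj_vec_of_mem (isSeqTree_fan ν K) (Or.inl h), m.treeProj_vec_of_mem hc (Or.inl h)]
    · filter_upwards [eventually_ge_atTop {k}] with K hK
      have hk : k ∈ K := hK (Finset.mem_singleton_self k)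
      rw [sum_childProj, _root_.sub_apply, _root_.sub_apply,
        m.treeProj_vec_of_mem (isSeqTree_fan ν K) (Or.inr ⟨k, hk, h⟩),
        m.treeProj_vec_of_mem hc (Or.inr ((List.prefix_append _ _).trans h))]
    · refine Eventually.of_forall fun K => ?_
      beta_reduce
      rw [sum_childProj, _root_.sub_apply, _root_.sub_apply,
        m.treeProj_vec_of_notMem (isSeqTree_fan ν K), m.treeProj_vec_of_notMem hc h]
      rintro (h' | ⟨k, -, h'⟩)
      · exact h (Or.inl h')
      · exact h (Or.inr ((List.prefix_append _ _).trans h'))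

/-- The upper `ℓ²`-estimate: a tree functional acts on child `k` with weight `α k`, and
Cauchy–Schwarz uses `∑ α k ^ 2 ≤ 1`. -/
theorem norm_sum_childProj_le (ν : List ℕ) (K : Finset ℕ) (x : E) :
    ‖∑ k ∈ K, m.childProj ν k x‖ ≤ √(∑ k ∈ K, ‖m.childProj ν k x‖ ^ 2) := by
  refine m.denseRange.induction_on (p := fun x => ‖∑ k ∈ K, m.childProj ν k x‖ ≤
    √(∑ k ∈ K, ‖m.childProj ν k x‖ ^ 2)) x (isClosed_le (by fun_prop) (by fun_prop)) fun v => ?_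
  set S : ℕ → Set (List ℕ) := fun k => {η | ν ++ [k] <+: η} with hS
  have h1 : ∑ k ∈ K, m.childProj ν k (m.ι v) =
      m.ι (restr (comparable ν) (∑ k ∈ K, restr (S k) v)) := by
    simp only [map_sum, restr_restr, childProj_ι]
    refine Finset.sum_congr rfl fun k _ => ?_
    rw [Set.inter_eq_right.2]
    exact fun η hη => Or.inr ((List.prefix_append _ _).trans hη)
  rw [h1, m.norm_ι_restr_comparable, ← m.treeSum_eq]
  refine treeSum_le m.isBranchFamily.single fun φ hφ => ?_
  obtain ⟨ψ, α, a1, a2, a3, a4, a5, a6⟩ := hφ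
  have h2 : ∀ k, φ (restr (S k) v) = α k * ψ k (restr (S k) v) := fun k => by
    refine LinearMap.congr_fun (f := φ.comp (restr (S k)))
      (g := (α k : 𝕜) • (ψ k).comp (restr (S k))) (TreeVec.linearMap_ext fun η => ?_) v
    by_cases hη : η ∈ S k
    · simp [restr_single_of_mem hη, a5 k η hη, RCLike.real_smul_eq_coe_mul]
    · simp [restr_single_of_notMem hη]
  calc ‖φ (∑ k ∈ K, restr (S k) v)‖ ≤ ∑ k ∈ K, ‖φ (restr (S k) v)‖ := by
        rw [map_sum]
        exact norm_sum_le _ _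
    _ ≤ ∑ k ∈ K, α k * ‖m.childProj ν k (m.ι v)‖ := Finset.sum_le_sum fun k _ => by
        rw [h2, norm_mul, RCLike.norm_ofReal, abs_of_nonneg (a2 k).1, childProj_ι]
        exact mul_le_mul_of_nonneg_left ((a1 k _).trans (m.N_le _ _)) (a2 k).1
    _ ≤ √(∑ k ∈ K, α k ^ 2) * √(∑ k ∈ K, ‖m.childProj ν k (m.ι v)‖ ^ 2) :=
        Real.sum_mul_le_sqrt_mul_sqrt _ _ _
    _ ≤ √(∑ k ∈ K, ‖m.childProj ν k (m.ι v)‖ ^ 2) :=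
        mul_le_of_le_one_left (Real.sqrt_nonneg _) (Real.sqrt_le_one.2 (a3 K))

/-- The projection onto the stem, as a map into it. -/
noncomputable def toStem (ν : List ℕ) : E →L[𝕜] m.stem ν :=
  (m.treeProj (prefixes ν)).codRestrict (m.stem ν) (m.stemProj_mem ν)

/-- The projection onto a child, as a map into it. -/
noncomputable def toChild (ν : List ℕ) (k : ℕ) : E →L[𝕜] m.child ν k :=
  (m.childProj ν k).codRestrict (m.child ν k) (m.childProj_mem ν k)

theorem coe_toStem (ν : List ℕ) (x : E) : (m.toStem ν x : E) = m.treeProj (prefixes ν) x := rfl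

theorem coe_toChild (ν : List ℕ) (k : ℕ) (x : E) : (m.toChild ν k x : E) = m.childProj ν k x := rfl

/-- The functionals of the generalized `ℓ²`-sum are contractive. -/
theorem norm_functional_le {ν : List ℕ} {x' : StrongDual 𝕜 (m.stem ν)}
    {y' : ∀ k, StrongDual 𝕜 (m.child ν k)} {α : ℕ → ℝ}
    (h : ∀ k (x : m.stem ν) (y : m.child ν k), ‖x' x + y' k y‖ ≤ ‖(x : E) + y‖)
    (hα : ∀ k, 0 ≤ α k ∧ α k ≤ 1) {K : Finset ℕ} (hK : ∑ k ∈ K, α k ^ 2 ≤ 1) (w : E) :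
    ‖x' (m.toStem ν w) + ∑ k ∈ K, (α k : 𝕜) * y' k (m.toChild ν k w)‖ ≤ ‖w‖ := by
  classical
  refine m.denseRange.induction_on (p := fun w => ‖x' (m.toStem ν w) +
    ∑ k ∈ K, (α k : 𝕜) * y' k (m.toChild ν k w)‖ ≤ ‖w‖) w
    (isClosed_le (by fun_prop) (by fun_prop)) fun v => ?_
  let φ : TreeVec 𝕜 →ₗ[𝕜] 𝕜 := ((x'.comp (m.toStem ν) +
    ∑ k ∈ K, (α k : 𝕜) • (y' k).comp (m.toChild ν k) : StrongDual 𝕜 E) : E →ₗ[𝕜] 𝕜).comp m.ι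
  have hφ : ∀ v, φ v = x' (m.toStem ν (m.ι v)) +
      ∑ k ∈ K, (α k : 𝕜) * y' k (m.toChild ν k (m.ι v)) := fun v => by
    simp [φ, RCLike.real_smul_eq_coe_mul]
  have hs0 : ∀ η, η ∉ prefixes ν → m.toStem ν (m.vec η) = 0 := fun η hη =>
    Subtype.ext (m.treeProj_vec_of_notMem (isSeqTree_prefixes ν) hη)
  have hc0 : ∀ k η, ¬ ν ++ [k] <+: η → m.toChild ν k (m.vec η) = 0 := fun k η hη =>
    Subtype.ext (m.childProj_vec_of_not_prefix hη)
  rw [← hφ]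
  refine (m.norm_le_N (ν := ν) ?_ v).trans (m.N_le ν v)
  refine ⟨fun k => ((x'.comp (m.toStem ν) + (y' k).comp (m.toChild ν k) : StrongDual 𝕜 E) :
    -- Weights are cut off outside `K`, while the components keep their full form, so that each
    -- still agrees with `φ` on the stem.
    E →ₗ[𝕜] 𝕜).comp m.ι, fun k => if k ∈ K then α k else 0, fun k v => ?_, fun k => ?_,
    fun K' => ?_, fun k η hη => ?_, fun k η hη => ?_, fun η hη => ?_⟩
  · refine (h k (m.toStem ν (m.ι v)) (m.toChild ν k (m.ι v))).trans ?_
    rw [coe_toStem, coe_toChild, childProj_apply, add_sub_cancel,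
      m.treeProj_ι (isSeqTree_comparable _), m.norm_ι_restr_comparable]
  · dsimp only
    split_ifs
    · exact hα k
    · exact ⟨le_rfl, zero_le_one⟩
  · refine le_trans ?_ hK
    calc ∑ k ∈ K', (if k ∈ K then α k else 0) ^ 2 = ∑ k ∈ K' with k ∈ K, α k ^ 2 := by
          rw [Finset.sum_filter]
          exact Finset.sum_congr rfl fun k _ => by split_ifs <;> simp
      _ ≤ ∑ k ∈ K, α k ^ 2 := Finset.sum_le_sum_of_subset_of_nonneg
          (fun k hk => (Finset.mem_filter.1 hk).2) fun _ _ _ => sq_nonneg _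
  · rw [hφ, Finset.sum_eq_zero, add_zero]
    · have : m.toChild ν k (m.vec η) = 0 := hc0 k η (List.not_concat_prefix_of_prefix hη)
      rw [vec] at this
      simp [this]
    · intro j _
      have : m.toChild ν j (m.vec η) = 0 := hc0 j η (List.not_concat_prefix_of_prefix hη)
      rw [vec] at this
      simp [this]
  · have h1 : m.toStem ν (m.vec η) = 0 :=
      hs0 η fun h' => List.not_concat_prefix_of_prefix h' hη
    have h2 : ∀ j, j ≠ k → m.toChild ν j (m.vec η) = 0 := fun j hj =>
      hc0 j η fun h' => hj (List.eq_of_concat_prefix h' hη)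
    rw [vec] at h1
    simp only [vec] at h2
    rw [hφ, h1, map_zero, zero_add]
    by_cases hk : k ∈ K
    · rw [Finset.sum_eq_single_of_mem k hk fun j _ hj => by rw [h2 j hj, map_zero, mul_zero]]
      simp [hk, h1]
    · rw [Finset.sum_eq_zero fun j hj => by
        rw [h2 j (by rintro rfl; exact hk hj), map_zero, mul_zero]]
      simp [hk]
  · have h1 : m.toStem ν (m.vec η) = 0 := hs0 η fun h' => hη (Or.inl h')
    have h2 : ∀ j, m.toChild ν j (m.vec η) = 0 := fun j =>
      hc0 j η fun h' => hη (Or.inr ((List.prefix_append _ _).trans h'))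
    rw [vec] at h1
    simp only [vec] at h2
    rw [hφ, h1, map_zero, zero_add]
    exact Finset.sum_eq_zero fun j _ => by rw [h2 j, map_zero, mul_zero]

theorem norm_stem_le {ν : List ℕ} {k : ℕ} {x y : E} (hx : x ∈ m.stem ν) (hy : y ∈ m.child ν k) :
    ‖x‖ ≤ ‖x + y‖ := by
  have := m.norm_treeProj_apply_le (isSeqTree_prefixes ν) (x + y)
  rwa [map_add, m.stemProj_of_mem_stem hx, m.stemProj_of_mem_child hy, add_zero] at this

/-- The lower `ℓ²`-estimate: test with norming functionals of the pieces, weighted by the normalized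
vector of their norms. The constant `2` comes from `‖y‖ ≤ 2 * ‖x + y‖`, so half of a norming
functional is admissible with zero stem part. -/
theorem sum_sq_norm_childProj_le (ν : List ℕ) (K : Finset ℕ) (w : E) :
    ∑ k ∈ K, ‖m.childProj ν k w‖ ^ 2 ≤ (2 * ‖w‖) ^ 2 := by
  set S := ∑ k ∈ K, ‖m.childProj ν k w‖ ^ 2 with hS
  have hS0 : 0 ≤ S := Finset.sum_nonneg fun _ _ => sq_nonneg _
  rcases hS0.eq_or_lt with h0 | hpos
  · rw [← h0]
    positivity
  have hs : 0 < √S := Real.sqrt_pos.2 hpos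
  choose g hg hgw using fun k => exists_dual_vector'' 𝕜 (m.childProj ν k w)
  have hsq : √S ^ 2 = S := Real.sq_sqrt hS0
  have key := m.norm_functional_le (ν := ν) (x' := 0)
    (y' := fun k => ((2⁻¹ : ℝ) : 𝕜) • (g k).comp (m.child ν k).subtypeL)
    (α := fun k => if k ∈ K then ‖m.childProj ν k w‖ / √S else 0) (K := K)
    (fun k x y => ?_) (fun k => ?_) ?_ w
  · have e : (0 : StrongDual 𝕜 (m.stem ν)) (m.toStem ν w) + ∑ k ∈ K,
        (((if k ∈ K then ‖m.childProj ν k w‖ / √S else 0 : ℝ)) : 𝕜) *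
          (((2⁻¹ : ℝ) : 𝕜) • (g k).comp (m.child ν k).subtypeL) (m.toChild ν k w) =
        ((2⁻¹ * √S : ℝ) : 𝕜) := by
      have h1 : ∀ k ∈ K, (((if k ∈ K then ‖m.childProj ν k w‖ / √S else 0 : ℝ)) : 𝕜) *
          (((2⁻¹ : ℝ) : 𝕜) • (g k).comp (m.child ν k).subtypeL) (m.toChild ν k w) =
          ((2⁻¹ * (‖m.childProj ν k w‖ ^ 2 / √S) : ℝ) : 𝕜) := fun k hk => by
        have h2 : (((2⁻¹ : ℝ) : 𝕜) • (g k).comp (m.child ν k).subtypeL) (m.toChild ν k w) =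
            ((2⁻¹ : ℝ) : 𝕜) * (‖m.childProj ν k w‖ : 𝕜) := by
          rw [← hgw k]
          rfl
        rw [h2, if_pos hk, ← RCLike.ofReal_mul, ← RCLike.ofReal_mul]
        congr 1
        ring
      rw [Finset.sum_congr rfl h1, ← RCLike.ofReal_sum, ← Finset.mul_sum, ← Finset.sum_div, ← hS,
        Real.div_sqrt]
      simp
    rw [e, RCLike.norm_ofReal, abs_of_nonneg (by positivity)] at key
    rw [← hsq]
    exact pow_le_pow_left₀ hs.le (by linarith) 2
  · have h1 : ‖g k y‖ ≤ ‖(y : E)‖ := by simpa using (g k).le_of_opNorm_le (hg k) (y : E)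
    have h2 := m.norm_stem_le x.2 y.2
    have h3 : ‖(y : E)‖ ≤ ‖(x : E) + y‖ + ‖(x : E)‖ := by
      simpa using norm_sub_le ((x : E) + y) x
    have e : (0 : StrongDual 𝕜 (m.stem ν)) x +
        (((2⁻¹ : ℝ) : 𝕜) • (g k).comp (m.child ν k).subtypeL) y = ((2⁻¹ : ℝ) : 𝕜) * g k y := by
      rw [_root_.zero_apply, zero_add]
      rfl
    rw [e, norm_mul, RCLike.norm_ofReal, abs_of_nonneg (by positivity)]
    linarith
  · split_ifs with hk
    · refine ⟨by positivity, (div_le_one hs).2 (Real.le_sqrt_of_sq_le ?_)⟩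
      exact Finset.single_le_sum (f := fun k => ‖m.childProj ν k w‖ ^ 2)
        (fun _ _ => sq_nonneg _) hk
    · exact ⟨le_rfl, zero_le_one⟩
  · rw [Finset.sum_congr rfl fun k hk => by rw [if_pos hk, div_pow, hsq], ← Finset.sum_div, ← hS,
      div_self hpos.ne']

end TreeModel

theorem ambientNorm_apply {𝕜 E : Type*} [RCLike 𝕜] [NormedAddCommGroup E] [NormedSpace 𝕜 E]
    {X Y : Submodule 𝕜 E} (x : X) (y : Y) : ambientNorm X Y (x, y) = ‖(x : E) + y‖ := rfl

/-! ### Identification of `E_ν` with the generalized `ℓ²`-sum. -/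

namespace TreeModel

variable {𝕜 : Type*} [RCLike 𝕜] {F : Type*} [NormedAddCommGroup F] [NormedSpace 𝕜 F]
  {f : SchauderBasis 𝕜 F} {E : Type*} [NormedAddCommGroup E] [NormedSpace 𝕜 E]
  (m : TreeModel f E) [CompleteSpace E]

theorem memℓp_toChild (ν : List ℕ) (w : E) : Memℓp (fun k => m.toChild ν k w) 2 := by
  refine memℓp_gen ?_
  have : Summable fun k => ‖m.childProj ν k w‖ ^ 2 :=
    summable_of_sum_le (fun _ => sq_nonneg _) (m.sum_sq_norm_childProj_le ν · w)
  simpa using! this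

/-- The decomposition of a vector along the stem and the children of `ν`. -/
noncomputable def decomp (ν : List ℕ) : E →ₗ[𝕜] GenSum (m.stem ν) (fun k => m.child ν k) where
  toFun w := (m.toStem ν w, ⟨fun k => m.toChild ν k w, m.memℓp_toChild ν w⟩)
  map_add' v w := by
    refine Prod.ext (map_add _ _ _) (lp.ext (funext fun k => ?_))
    exact map_add (m.toChild ν k) _ _
  map_smul' c w := by
    refine Prod.ext (map_smul _ _ _) (lp.ext (funext fun k => ?_))
    exact map_smul (m.toChild ν k) _ _

theorem decomp_fst (ν : List ℕ) (w : E) : (m.decomp ν w).1 = m.toStem ν w := rfl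

theorem decomp_snd (ν : List ℕ) (w : E) (k : ℕ) : (m.decomp ν w).2 k = m.toChild ν k w := rfl

theorem hasSum_toChild {ν : List ℕ} {w : E} (hw : w ∈ closedSpan (𝕜 := 𝕜) m.vec (comparable ν)) :
    HasSum (fun k => (m.toChild ν k w : E)) (w - m.toStem ν w) := by
  have := m.hasSum_childProj ν w
  rwa [m.treeProj_eq_self (isSeqTree_comparable ν) hw] at this

theorem norm_le_of_mem_genLambda {ν : List ℕ} {φ : GenSum (m.stem ν) (fun k => m.child ν k) → 𝕜}
    (hφ : φ ∈ genLambda fun k => ambientNorm (m.stem ν) (m.child ν k)) (w : E) :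
    ‖φ (m.decomp ν w)‖ ≤ ‖w‖ := by
  obtain ⟨x', y', α, h1, h2, h3, h4, h5⟩ := hφ
  have hK : ∀ K : Finset ℕ, ∑ k ∈ K, α k ^ 2 ≤ 1 := fun K =>
    (h3.sum_le_tsum K fun _ _ => sq_nonneg _).trans h4
  have key := fun K => m.norm_functional_le h1 h2 (hK K) w
  rw [h5]
  simp only [decomp_fst, decomp_snd]
  by_cases hs : Summable fun k => (α k : 𝕜) * y' k (m.toChild ν k w)
  · have := (hs.hasSum.const_add (x' (m.toStem ν w))).norm
    exact le_of_tendsto this (Eventually.of_forall key)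
  -- The default value `0` of a divergent series leaves the stem term, which is the case of an empty
  -- set of children.
  · rw [tsum_eq_zero_of_not_summable hs]
    simpa using key ∅

/-- For the lower bound, an almost norming tree functional and its components are extended by
continuity to `E`. Restricted to the stem and the children they form an element of `genLambda`,
whose value at the decomposition of `w` is that of the extended functional at `w`. -/
theorem genNorm_decomp {ν : List ℕ} {w : E}
    (hw : w ∈ closedSpan (𝕜 := 𝕜) m.vec (comparable ν)) :
    genNorm (fun k => ambientNorm (m.stem ν) (m.child ν k)) (m.decomp ν w) = ‖w‖ := by
  have hle : ∀ t ∈ (fun φ : GenSum (m.stem ν) (fun k => m.child ν k) → 𝕜 =>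
      ‖φ (m.decomp ν w)‖) '' genLambda fun k => ambientNorm (m.stem ν) (m.child ν k),
      t ≤ ‖w‖ := by
    rintro _ ⟨φ, hφ, rfl⟩
    exact m.norm_le_of_mem_genLambda hφ w
  refine le_antisymm (Real.sSup_le hle (norm_nonneg w)) (le_of_forall_pos_le_add fun ε hε => ?_)
  -- The three thirds of `ε` pay for replacing `w` by `v` in the norm, for a functional that is only
  -- almost norming, and for returning from `v` to `w`.
  obtain ⟨v, hv⟩ := m.denseRange.exists_dist_lt w (ε := ε / 3) (by positivity)
  rw [dist_eq_norm] at hv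
  have h1 : ‖w‖ ≤ m.N ν v + ε / 3 := by
    have h2 : ‖m.treeProj (comparable ν) (w - m.ι v)‖ ≤ ε / 3 :=
      (m.norm_treeProj_apply_le (isSeqTree_comparable ν) _).trans hv.le
    rw [map_sub, m.treeProj_eq_self (isSeqTree_comparable ν) hw,
      m.treeProj_ι (isSeqTree_comparable ν)] at h2
    rw [← m.norm_ι_restr_comparable]
    linarith [norm_le_insert' w (m.ι (restr (comparable ν) v))]
  obtain ⟨φ, hφ, h3⟩ := exists_lt_norm_of_lt_treeSum m.isBranchFamily.single
    (N := m.N) (ν := ν) (v := v) (C := m.N ν v - ε / 3) (by rw [m.treeSum_eq]; linarith)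
  have hφ' : ∀ v, ‖φ v‖ ≤ 1 * ‖m.ι v‖ := fun v => by
    rw [one_mul]
    exact (m.norm_le_N hφ v).trans (m.N_le ν v)
  obtain ⟨ψ, α, a1, a2, a3, a4, a5, a6⟩ := hφ
  have hψ : ∀ k v, ‖ψ k v‖ ≤ 1 * ‖m.ι v‖ := fun k v => by
    rw [one_mul]
    exact (a1 k v).trans (m.N_le _ v)
  let Φ : StrongDual 𝕜 E := φ.extendOfNorm m.ι
  let Ψ : ℕ → StrongDual 𝕜 E := fun k => (ψ k).extendOfNorm m.ι
  have hΦ : ∀ v, Φ (m.ι v) = φ v := LinearMap.extendOfNorm_eq m.denseRange ⟨1, hφ'⟩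
  have hΨ : ∀ k v, Ψ k (m.ι v) = ψ k v := fun k =>
    LinearMap.extendOfNorm_eq m.denseRange ⟨1, hψ k⟩
  have hΦle : ∀ x, ‖Φ x‖ ≤ ‖x‖ := fun x => by
    have := LinearMap.norm_extendOfNorm_apply_le m.denseRange 1 hφ' x
    rwa [one_mul] at this
  have hΨle : ∀ k x, ‖Ψ k x‖ ≤ ‖x‖ := fun k x => by
    have := LinearMap.norm_extendOfNorm_apply_le m.denseRange 1 (hψ k) x
    rwa [one_mul] at this
  have hstem : ∀ k, ∀ x ∈ m.stem ν, Φ x = Ψ k x := fun k x hx =>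
    m.apply_eq_of_mem_closedSpan (A := Φ) (B := Ψ k)
      (fun η hη => by rw [vec, hΦ, hΨ, a4 k η hη]) hx
  have hchild : ∀ k, ∀ y ∈ m.child ν k, Φ y = α k * Ψ k y := fun k y hy =>
    m.apply_eq_of_mem_closedSpan (A := Φ) (B := (α k : 𝕜) • Ψ k) (fun η hη => by
      rw [vec, hΦ, a5 k η hη, ← hΨ]
      rfl) hy
  let θ : GenSum (m.stem ν) (fun k => m.child ν k) → 𝕜 := fun z =>
    Φ z.1 + ∑' k, (α k : 𝕜) * Ψ k (z.2 k)
  have hθ : θ ∈ genLambda fun k => ambientNorm (m.stem ν) (m.child ν k) := by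
    have hsum := summable_of_sum_le (fun k => sq_nonneg (α k)) a3
    refine ⟨Φ.comp (m.stem ν).subtypeL, fun k => (Ψ k).comp (m.child ν k).subtypeL, α,
      fun k x y => ?_, a2, hsum, hsum.tsum_le_of_sum_le a3, fun z => rfl⟩
    rw [ambientNorm_apply]
    have : Φ x + Ψ k y = Ψ k (x + y) := by rw [hstem k x x.2, map_add]
    exact (congr_arg norm this).le.trans (hΨle k _)
  have hval : θ (m.decomp ν w) = Φ w := by
    have h4 := ((m.hasSum_toChild hw).mapL Φ).tsum_eq
    simp only [θ, decomp_fst, decomp_snd]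
    rw [map_sub] at h4
    rw [← tsum_congr fun k => hchild k _ (m.toChild ν k w).2, h4]
    abel
  have h5 : ‖Φ w‖ ≤ sSup ((fun φ : GenSum (m.stem ν) (fun k => m.child ν k) → 𝕜 =>
      ‖φ (m.decomp ν w)‖) '' genLambda fun k => ambientNorm (m.stem ν) (m.child ν k)) :=
    le_csSup ⟨_, hle⟩ ⟨θ, hθ, congr_arg norm hval⟩
  have h6 : ‖φ v‖ ≤ ‖Φ w‖ + ε / 3 := by
    have h7 := (hΦle (w - m.ι v)).trans hv.le
    rw [map_sub, hΦ] at h7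
    linarith [norm_le_insert (Φ w) (φ v)]
  unfold genNorm
  linarith

/-- A square summable choice of vectors of the children can be summed. -/
theorem exists_decomp_eq (ν : List ℕ) (z : GenSum (m.stem ν) (fun k => m.child ν k)) :
    ∃ w ∈ closedSpan (𝕜 := 𝕜) m.vec (comparable ν), m.decomp ν w = z := by
  obtain ⟨x, y⟩ := z
  have hchild : ∀ j k, m.childProj ν k (y j) = if j = k then (y j : E) else 0 := fun j k => by
    split_ifs with h
    · subst h
      exact m.childProj_of_mem_child (y j).2
    · exact m.childProj_of_mem_child_of_ne h (y j).2
  have hy2 : Summable fun k => ‖(y k : E)‖ ^ 2 := by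
    have := (lp.memℓp y).summable (by norm_num)
    simpa using! this
  have hle : ∀ K : Finset ℕ, ‖∑ k ∈ K, (y k : E)‖ ≤ √(∑ k ∈ K, ‖(y k : E)‖ ^ 2) := fun K => by
    -- The upper estimate is applied to the finite sum itself, whose child projections are the
    -- vectors `y k`.
    have h := m.norm_sum_childProj_le ν K (∑ k ∈ K, (y k : E))
    have h' : ∀ k ∈ K, m.childProj ν k (∑ j ∈ K, (y j : E)) = y k := fun k hk => by
      rw [map_sum, Finset.sum_congr rfl fun j _ => hchild j k, Finset.sum_ite_eq' K k, if_pos hk]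
    have hs : ∑ k ∈ K, ‖m.childProj ν k (∑ j ∈ K, (y j : E))‖ ^ 2 = ∑ k ∈ K, ‖(y k : E)‖ ^ 2 :=
      Finset.sum_congr rfl fun k hk => by rw [h' k hk]
    rwa [hs, Finset.sum_congr rfl h'] at h
  have hy : Summable fun k => (y k : E) := by
    rw [summable_iff_vanishing_norm]
    intro ε hε
    obtain ⟨s, hs⟩ := summable_iff_vanishing_norm.1 hy2 (ε ^ 2) (by positivity)
    refine ⟨s, fun t ht => (hle t).trans_lt ?_⟩
    rw [Real.sqrt_lt' hε]
    exact (le_abs_self _).trans_lt (hs t ht)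
  have hxZ : (x : E) ∈ closedSpan (𝕜 := 𝕜) m.vec (comparable ν) :=
    closedSpan_mono _ (fun _ h => Or.inl h) x.2
  have hyZ : ∀ k, (y k : E) ∈ closedSpan (𝕜 := 𝕜) m.vec (comparable ν) := fun k =>
    closedSpan_mono _ (fun _ h => Or.inr ((List.prefix_append _ _).trans h)) (y k).2
  refine ⟨x + ∑' k, (y k : E), add_mem hxZ ?_, Prod.ext (Subtype.ext ?_)
    (lp.ext (funext fun k => Subtype.ext ?_))⟩
  · exact (isClosed_closedSpan m.vec (comparable ν)).mem_of_tendsto hy.hasSum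
      (Eventually.of_forall fun K => sum_mem fun k _ => hyZ k)
  · change m.treeProj (prefixes ν) _ = (x : E)
    rw [map_add, m.stemProj_of_mem_stem x.2, ContinuousLinearMap.map_tsum _ hy,
      tsum_congr fun k => m.stemProj_of_mem_child (y k).2, tsum_zero, add_zero]
  · change m.childProj ν k _ = (y k : E)
    rw [map_add, m.childProj_of_mem_stem k x.2, ContinuousLinearMap.map_tsum _ hy,
      tsum_congr fun j => hchild j k, tsum_ite_eq, zero_add]

theorem isGenSum (ν : List ℕ) : IsGenSum (𝕜 := 𝕜) (closedSpan m.vec (comparable ν))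
    (fun k => closedSpan m.vec (comparable (ν ++ [k]))) (m.stem ν) (fun k => m.child ν k) := by
  refine ⟨fun k => ⟨?_, ?_⟩, ⟨fun k x => ?_, fun k y => ?_, fun k x y => ?_⟩, ?_⟩
  · rw [Submodule.disjoint_def]
    intro x hx hy
    rw [← m.stemProj_of_mem_stem hx, m.stemProj_of_mem_child hy]
  · refine le_antisymm (sup_le ?_ ?_) fun w hw => ?_
    · exact closedSpan_mono _ fun η h => Or.inl (List.IsPrefix.trans h (List.prefix_append _ _))
    · exact closedSpan_mono _ fun η h => Or.inr h
    · have : w = m.treeProj (prefixes ν) w + m.childProj ν k w := by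
        rw [childProj_apply, m.treeProj_eq_self (isSeqTree_comparable _) hw]
        abel
      rw [this]
      exact Submodule.add_mem_sup (m.stemProj_mem ν w) (m.childProj_mem ν k w)
  · rw [ambientNorm_apply]
    simp
  · rw [ambientNorm_apply]
    simp
  · exact m.norm_stem_le x.2 y.2
  -- The required isometry is the inverse of the decomposition map restricted to `E_ν`.
  · have hinj : Function.Injective ((m.decomp ν).comp
        (closedSpan (𝕜 := 𝕜) m.vec (comparable ν)).subtype) := by
      rw [injective_iff_map_eq_zero]
      rintro ⟨w, hw⟩ h
      have h0 : m.decomp ν w = 0 := h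
      have h1 : m.toStem ν w = 0 := by rw [← decomp_fst, h0]; rfl
      have h2 : ∀ k, m.toChild ν k w = 0 := fun k => by rw [← decomp_snd, h0]; rfl
      have h3 := m.hasSum_toChild hw
      simp only [h1, h2, ZeroMemClass.coe_zero, sub_zero] at h3
      exact Subtype.ext (h3.unique hasSum_zero)
    have hsurj : Function.Surjective ((m.decomp ν).comp
        (closedSpan (𝕜 := 𝕜) m.vec (comparable ν)).subtype) := fun z => by
      obtain ⟨w, hw, rfl⟩ := m.exists_decomp_eq ν z
      exact ⟨⟨w, hw⟩, rfl⟩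
    refine ⟨(LinearEquiv.ofBijective _ ⟨hinj, hsurj⟩).symm, fun z => ?_⟩
    obtain ⟨w, rfl⟩ := (LinearEquiv.ofBijective _ ⟨hinj, hsurj⟩).surjective z
    rw [LinearEquiv.symm_apply_apply]
    exact ⟨m.hasSum_toChild w.2, (m.genNorm_decomp w.2).symm⟩

end TreeModel

/-! ### Assembly of the proposition. -/

theorem exists_treeModel {𝕜 : Type u} [RCLike 𝕜] {F : Type v} [NormedAddCommGroup F]
    [NormedSpace 𝕜 F] (f : SchauderBasis 𝕜 F) (hf : ∀ n, ‖SchauderBasis.proj f n‖ ≤ 1) :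
    ∃ (E : Type u) (_ : NormedAddCommGroup E) (_ : NormedSpace 𝕜 E) (_ : CompleteSpace E),
      Nonempty (TreeModel f E) := by
  obtain ⟨N, hN, hfix⟩ := exists_isBranchFamily_treeSum_eq hf
  obtain ⟨E, i1, i2, i3, ι, hd, hι⟩ := Seminorm.exists_completion (N [])
  exact ⟨E, i1, i2, i3, ⟨⟨hf, N, hN, hfix, ι, hd, hι⟩⟩⟩

theorem mainTheorem5 {𝕜 : Type u} [RCLike 𝕜]
    {F : Type v} [NormedAddCommGroup F] [NormedSpace 𝕜 F] [CompleteSpace F]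
    (f : SchauderBasis 𝕜 F) (hf : ∀ n, ‖SchauderBasis.proj f n‖ ≤ 1) :
    ∃ (E : Type u) (_ : NormedAddCommGroup E) (_ : NormedSpace 𝕜 E) (_ : CompleteSpace E)
      (e : GeneralSchauderBasis (List ℕ) 𝕜 E finiteTrees),
      -- (a) finite branches
      (∀ (ν : List ℕ) (r : ℕ → 𝕜),
        ‖∑ i ∈ Finset.range (ν.length + 1), r i • e (ν.take i)‖ =
          ‖∑ i ∈ Finset.range (ν.length + 1), r i • f i‖) ∧
      -- (b) `E_ν = Σ(E_{ν,k})`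
      (∀ ν : List ℕ,
        IsGenSum (𝕜 := 𝕜)
          (closedSpan e {η | η <+: ν ∨ ν <+: η})
          (fun k => closedSpan e {η | η <+: ν ++ [k] ∨ ν ++ [k] <+: η})
          (closedSpan e {η | η <+: ν})
          (fun k => closedSpan e {η | ν ++ [k] <+: η})) ∧
      -- (c) tree projections
      (∀ T : Set (List ℕ), IsSeqTree T →
        ∃ P : E →L[𝕜] E,
          (∀ x, HasSum (T.indicator fun η => e.coord η x • e η) (P x) finiteTrees) ∧ ‖P‖ ≤ 1) ∧
      -- (d) splitting along initial segments
      (∀ (l : ℕ) (c : ℝ), 0 < c →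
        (∀ x : F, ‖SchauderBasis.proj f (l + 1) x‖ + c * ‖x - SchauderBasis.proj f (l + 1) x‖
          ≤ ‖x‖) →
        ∀ ν : List ℕ, ν.length = l →
          ∀ x ∈ closedSpan (𝕜 := 𝕜) e {η | η <+: ν ∨ ν <+: η},
            ∃ y z : E,
              HasSum ({η | η <+: ν}.indicator fun η => e.coord η x • e η) y finiteTrees ∧
              HasSum ({η | ν <+: η ∧ η ≠ ν}.indicator fun η => e.coord η x • e η) z finiteTrees ∧
              ‖y‖ + c * ‖z‖ ≤ ‖x‖) := by
  obtain ⟨E, i1, i2, i3, ⟨m⟩⟩ := exists_treeModel f hf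
  refine ⟨E, i1, i2, i3, m.basis, m.norm_sum_take, m.isGenSum, fun T hT => ?_, ?_⟩
  · exact ⟨m.treeProj T, m.hasSum_treeProj hT, ContinuousLinearMap.opNorm_le_bound _ zero_le_one
      fun x => by simpa using m.norm_treeProj_apply_le hT x⟩
  · rintro _ c hc hsplit ν rfl x hx
    have hP := isSeqTree_prefixes ν
    have hC := isSeqTree_comparable ν
    refine ⟨m.treeProj (prefixes ν) x, m.treeProj (comparable ν) x - m.treeProj (prefixes ν) x,
      m.hasSum_treeProj hP x, ?_, ?_⟩
    -- The proper extensions of `ν` do not form a tree; their sum is obtained as a difference of two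
    -- tree projections.
    · have h := (m.hasSum_treeProj hC x).sub (m.hasSum_treeProj hP x)
      convert h using 1
      funext η
      change Set.indicator _ (fun η => m.coord η x • m.vec η) η = _
      classical
      simp only [Set.indicator_apply, mem_comparable, mem_prefixes, Set.mem_ofPred_eq]
      by_cases h1 : η <+: ν
      · have h2 : ¬ (ν <+: η ∧ η ≠ ν) := fun h2 =>
          h2.2 (h1.eq_of_length_le h2.1.length_le)
        simp [h1, h2]
      · have h2 : (ν <+: η ∧ η ≠ ν) ↔ ν <+: η :=
          ⟨fun h => h.1, fun h => ⟨h, by rintro rfl; exact h1 h⟩⟩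
        simp [h1, h2]
    · have h := m.norm_treeProj_split ⟨hc, hsplit⟩ x
      rwa [m.treeProj_eq_self hC hx] at h ⊢
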